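/- Let $n\ge 0$ and let $\pi\in S_{n+1}$ be of the form $\pi=1\pi'$, i.e. $\pi(1)=1$, where $\pi'=\pi(2)\cdots\pi(n+1)$ is a dominant permutation of $\{2,\dots,n+1\}$: after relabelling $\pi'$ order-preservingly as a permutation $w$ of $\{1,\dots,n\}$, its diagram $\{(i,j): j<w(i),\ i<w^{-1}(j)\}$ is the Young diagram of a (possibly empty) partition, placed in the north-west corner. A pipe dream of $\pi$ is a tiling of the $(n+1)\times(n+1)$ matrix by crosses and elbows (an elbow tile joins its top edge to its left edge and its right edge to its bottom edge) in which all crosses $(i,j)$ satisfy $i+j\le n+1$ and such that, numbering the strands $1,\dots,n+1$ along the top and following them while ignoring second crossings of the same two strands, they come out on the left and read $\pi$ from top to bottom; it is reduced if no two strands cross twice. The weight $\mathrm{wt}(P)$ of a pipe dream $P$ is $\prod t_i$ over its crosses $(i,j)$. The Grothendieck and Schubert polynomials of $\pi$ are $$\mathfrak G_\pi(t_1,\dots,t_n)=\sum_{P \text{ pipe dream of } \pi}\mathrm{wt}(P),\qquad \mathfrak S_\pi(t_1,\dots,t_n)=\sum_{P\text{ reduced pipe dream of }\pi}\mathrm{wt}(P).$$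 For $f=\sum_\alpha c_\alpha \mathbf t^\alpha$ with $\alpha\in\mathbb Z_{\ge0}^n$, let $\mathrm{Newton}(f)\subset\mathbb R^n$ be the convex hull of $\{\alpha: c_\alpha\ne0\}$; $f$ has polytopal support if the integer points of $\mathrm{Newton}(f)$ are exactly the $\alpha$ with $c_\alpha\neq 0$. A generalized permutahedron is a set of the form $$\Big\{\mathbf t\in\mathbb R^n:\ \sum_{i\in I}t_i\ge z_I \text{ for all } I\subsetneq\{1,\dots,n\},\ \sum_{i=1}^n t_i=z_{\{1,\dots,n\}}\Big\}$$ with real numbers $z_I$ $(I\subseteq\{1,\dots,n\})$ such that $z_\emptyset=0$ and $z_{I\cup J}+z_{I\cap J}\ge z_I+z_J$ for all $I,J$. Then: 1. $\mathfrak G_\pi$ has polytopal support, and the Newton polytope of each nonzero homogeneous component of $\mathfrak G_\pi$ is a generalized permutahedron. 2. $\mathfrak S_\pi$ has polytopal support, $\mathrm{Newton}(\mathfrak S_\pi)$ is a generalized permutahedron, and $\mathfrak S_\pi$ is the integer-point transform of its Newton polytope: $\mathfrak S_\pi(\mathbf t)=\sum_{p\in \mathrm{Newton}(\mathfrak S_\pi)\cap\mathbb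 Z^n}\mathbf t^{p}$. -/

import Mathlib

/-- The exponent vectors of the monomials of `f` with nonzero coefficient, as points of `ℝⁿ`. -/
def exponentVectors {n : ℕ} (f : MvPolynomial (Fin n) ℤ) : Set (Fin n → ℝ) :=
  {x | ∃ α : Fin n →₀ ℕ, f.coeff α ≠ 0 ∧ x = fun i => (α i : ℝ)}

/-- The Newton polytope of a polynomial. -/
def newtonPolytope {n : ℕ} (f : MvPolynomial (Fin n) ℤ) : Set (Fin n → ℝ) :=
  convexHull ℝ (exponentVectors f)

/-- The integer points of a subset of `ℝⁿ`. -/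
def integerPoints {n : ℕ} (P : Set (Fin n → ℝ)) : Set (Fin n → ℤ) :=
  {p | (fun i => (p i : ℝ)) ∈ P}

/-- Polytopal support: the integer points of the Newton polytope are exactly the exponent vectors
of the monomials that appear in `f` with nonzero coefficient. -/
def HasPolytopalSupport {n : ℕ} (f : MvPolynomial (Fin n) ℤ) : Prop :=
  integerPoints (newtonPolytope f) =
    {p | ∃ α : Fin n →₀ ℕ, f.coeff α ≠ 0 ∧ p = fun i => (α i : ℤ)}

/-- The generalized permutahedron with parameters `z`. -/
def permutahedronOf {n : ℕ} (z : Finset (Fin n) → ℝ) : Set (Fin n → ℝ) :=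
  {t | (∀ I : Finset (Fin n), I ≠ Finset.univ → z I ≤ ∑ i ∈ I, t i) ∧
    ∑ i, t i = z Finset.univ}

/-- `P` is a generalized permutahedron: it is `permutahedronOf z` for some supermodular
parameters `z` with `z ∅ = 0`. -/
def IsGeneralizedPermutahedron {n : ℕ} (P : Set (Fin n → ℝ)) : Prop :=
  ∃ z : Finset (Fin n) → ℝ, z ∅ = 0 ∧
    (∀ I J : Finset (Fin n), z I + z J ≤ z (I ∪ J) + z (I ∩ J)) ∧
    P = permutahedronOf z

/-- A polynomial regarded as a Laurent polynomial, with exponents in `ℤⁿ`. -/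
noncomputable def toLaurent {n : ℕ} (f : MvPolynomial (Fin n) ℤ) :
    AddMonoidAlgebra ℤ (Fin n → ℤ) :=
  ∑ α ∈ f.support, AddMonoidAlgebra.single (fun i => (α i : ℤ)) (f.coeff α)

/-- `f` is the integer-point transform of `P`: the set `P ∩ ℤⁿ` is finite and
`f = ∑_{p ∈ P ∩ ℤⁿ} x ^ p`. -/
def IsIntegerPointTransform {n : ℕ} (f : MvPolynomial (Fin n) ℤ) (P : Set (Fin n → ℝ)) : Prop :=
  ∃ h : (integerPoints P).Finite,
    toLaurent f = ∑ p ∈ h.toFinset, AddMonoidAlgebra.single p (1 : ℤ)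

/-- The Rothe diagram `{(i, w j) : i < j, w i > w j}` of a permutation, in matrix coordinates. -/
def rotheDiagram {n : ℕ} (w : Equiv.Perm (Fin n)) : Set (Fin n × Fin n) :=
  {p | p.2 < w p.1 ∧ p.1 < w.symm p.2}

/-- A permutation is dominant if its diagram is the Young diagram of a (possibly empty) partition,
justified to the north-west corner. -/
def IsDominantPerm {n : ℕ} (w : Equiv.Perm (Fin n)) : Prop :=
  IsLowerSet (rotheDiagram w)

/-- The tiles of an `(n+1) × (n+1)` matrix (rows and columns numbered from `0`) strictly
north-west of the antidiagonal: those that may be crosses in a pipe dream. -/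
abbrev Tile (n : ℕ) : Type :=
  {p : Fin n × Fin n // (p.1 : ℕ) + (p.2 : ℕ) < n}

/-- The tiles, row by row from top to bottom, each row from right to left. -/
def tileList (n : ℕ) : List (Tile n) :=
  (List.finRange n).flatMap fun (i : Fin n) =>
    (List.finRange n).reverse.filterMap fun (j : Fin n) =>
      if h : (i : ℕ) + (j : ℕ) < n then some ⟨(i, j), h⟩ else none

/-- The cross tiles of a tiling with set of crosses `D`, in the order in which they are met. -/
def crossList {n : ℕ} (D : Finset (Tile n)) : List (Tile n) :=
  (tileList n).filter fun c => c ∈ D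

/-- Cut the matrix along the lattice path that separates the tiles already passed from the others.
The strands meet this path in `n + 1` edges, numbered from the south-west end to the north-east
end; `σ k` is the strand at edge `k`. The top and the right edge of the tile `c = (i, j)` are the
edges `topEdge c = i + j` and `rightEdge c = i + j + 1`; once `c` has been passed these are the
numbers of its left and its bottom edge. -/
def topEdge {n : ℕ} (c : Tile n) : Fin (n + 1) :=
  Fin.castSucc ⟨(c.1.1 : ℕ) + (c.1.2 : ℕ), c.2⟩

/-- See `topEdge`. -/
def rightEdge {n : ℕ} (c : Tile n) : Fin (n + 1) :=
  Fin.succ ⟨(c.1.1 : ℕ) + (c.1.2 : ℕ), c.2⟩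

/-- Passing an elbow leaves `σ` unchanged (top is joined to left and right to bottom). At a cross
the two strands are interchanged if they have not crossed before, that is, if they are still in
increasing order; a second crossing of the same two strands is ignored. -/
def passCross {n : ℕ} (σ : Equiv.Perm (Fin (n + 1))) (c : Tile n) : Equiv.Perm (Fin (n + 1)) :=
  if σ (topEdge c) < σ (rightEdge c) then σ * Equiv.swap (topEdge c) (rightEdge c) else σ

/-- The permutation of a tiling: the strands are numbered `0, …, n` along the top and followed
through all tiles; the value at `i` is the strand that comes out on the left in row `i`. -/
def strandPerm {n : ℕ} (D : Finset (Tile n)) : Equiv.Perm (Fin (n + 1)) :=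
  (crossList D).foldl passCross 1

/-- Starting from `σ`, the strands that meet at each cross of the list have not crossed before. -/
def NoSecondCrossing {n : ℕ} : List (Tile n) → Equiv.Perm (Fin (n + 1)) → Prop
  | [], _ => True
  | c :: l, σ => σ (topEdge c) < σ (rightEdge c) ∧ NoSecondCrossing l (passCross σ c)

/-- A tiling is reduced if no two strands cross twice. -/
def IsReducedTiling {n : ℕ} (D : Finset (Tile n)) : Prop :=
  NoSecondCrossing (crossList D) 1

/-- The pipe dreams of `w`, given by their sets of crosses. -/
def pipeDreams {n : ℕ} (w : Equiv.Perm (Fin (n + 1))) : Finset (Finset (Tile n)) :=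
  Finset.univ.filter fun D => strandPerm D = w

open scoped Classical in
/-- The reduced pipe dreams of `w`. -/
noncomputable def reducedPipeDreams {n : ℕ} (w : Equiv.Perm (Fin (n + 1))) :
    Finset (Finset (Tile n)) :=
  (pipeDreams w).filter fun D => IsReducedTiling D

/-- The weight of a pipe dream: the product of `t_i` over its crosses `(i, j)`. -/
noncomputable def pipeWeight {n : ℕ} (D : Finset (Tile n)) : MvPolynomial (Fin n) ℤ :=
  ∏ c ∈ D, MvPolynomial.X c.1.1

/-- The Grothendieck polynomial. -/
noncomputable def grothendieckPoly {n : ℕ} (w : Equiv.Perm (Fin (n + 1))) :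
    MvPolynomial (Fin n) ℤ :=
  ∑ D ∈ pipeDreams w, pipeWeight D

/-- The Schubert polynomial. -/
noncomputable def schubertPoly {n : ℕ} (w : Equiv.Perm (Fin (n + 1))) :
    MvPolynomial (Fin n) ℤ :=
  ∑ D ∈ reducedPipeDreams w, pipeWeight D

/-! Write `lam` for the Lehmer code of `π` without its first entry; dominance of `π'` makes it a
partition. The proof computes all exponents of the Grothendieck polynomial, finds that they are the
integer points of an explicit system of linear inequalities, and reads every claim off that system.

The sum over all tilings is a product of factors `1 + x u` in the 0-Hecke algebra. Since row factors
commute (Fomin–Kirillov), its coefficients satisfy a divided difference recursion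
(`tilingSum_divided`). For a 132-avoiding permutation the recursion collapses to the single monomial
given by the code (`tilingSum_of_avoids132`). Moving the smallest entry of `π` from the first to the
last position yields such a permutation, and undoing this move costs `n` divided differences at
consecutive positions. Each of them turns a monomial into two geometric sums (`divided_carry`), the
second of which has degree one higher. So `π` gets a sum of monomials with nonnegative
multiplicities, produced by a recursion whose only state is a carry (`carries`).

Nonnegativity excludes cancellation, so the support is the set of exponents that the recursion
reaches. Eliminating the carries leaves upper bounds on single coordinates, bounds on initial
partial sums, and a lower bound on the degree (`mem_tilingExponents`, `SupportInequalities`). These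
cut out a convex set, which gives polytopal support.

In a fixed degree only a box bounded from above and a chain of prefix bounds remain. Such a set is
M-convex (`symmetricExchange_of_box_chain`), and the hull of an M-convex set is a generalized
permutahedron by the greedy algorithm. The Schubert polynomial is the component of lowest degree;
there no step may choose its second geometric sum, so the carries are determined by the exponent and
every coefficient is one. -/

/-! ### M-convex sets and generalized permutahedra. -/

/-- The symmetric exchange property of M-convex sets. -/
def SymmetricExchange {n : ℕ} (A : Finset (Fin n → ℤ)) : Prop :=
  ∀ α ∈ A, ∀ β ∈ A, ∀ i, β i < α i → ∃ j, α j < β j ∧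
    α - Pi.single i 1 + Pi.single j 1 ∈ A ∧ β + Pi.single i 1 - Pi.single j 1 ∈ A

/-- Sum of a vector after moving a unit from coordinate `i` to coordinate `j`. -/
theorem sum_move {n : ℕ} (I : Finset (Fin n)) (α : Fin n → ℤ) (i j : Fin n) :
    ∑ l ∈ I, (α - Pi.single i 1 + Pi.single j 1 : Fin n → ℤ) l =
      ∑ l ∈ I, α l - (if i ∈ I then 1 else 0) + (if j ∈ I then 1 else 0) := by
  simp [Finset.sum_add_distrib, Finset.sum_sub_distrib, Pi.single_apply]

theorem move_comm {n : ℕ} (β : Fin n → ℤ) (i j : Fin n) :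
    β + Pi.single i 1 - Pi.single j 1 = β - Pi.single j 1 + Pi.single i 1 := by
  abel

/-- Some member of `A` minimizes simultaneously all sums over initial segments of the order given
by `τ`. -/
theorem SymmetricExchange.exists_greedy {n : ℕ} {A : Finset (Fin n → ℤ)} (hA : A.Nonempty)
    (hex : SymmetricExchange A) (τ : Equiv.Perm (Fin n)) :
    ∃ α ∈ A, ∀ I : Finset (Fin n),
      (∀ i ∈ I, ∀ j, τ.symm j < τ.symm i → j ∈ I) → ∀ β ∈ A, ∑ i ∈ I, α i ≤ ∑ i ∈ I, β i := by
  obtain ⟨α, hα, hmin⟩ := Finset.exists_min_image A (fun α => toLex (α ∘ τ)) hA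
  refine ⟨α, hα, fun I hI => ?_⟩
  by_contra! hcon
  obtain ⟨β₀, hβ₀, hlt₀⟩ := hcon
  -- Among the vectors that beat `α` on `I`, take one closest to `α` in the ℓ¹ norm.
  obtain ⟨β, hβ, hβmin⟩ := Finset.exists_min_image
    (A.filter fun β => ∑ i ∈ I, β i < ∑ i ∈ I, α i) (fun β => ∑ i, |α i - β i|)
    ⟨β₀, by simp [hβ₀, hlt₀]⟩
  simp only [Finset.mem_filter] at hβ hβmin
  obtain ⟨hβA, hlt⟩ := hβ
  obtain ⟨i, hiI, hi⟩ := Finset.exists_lt_of_sum_lt hlt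
  obtain ⟨j, hj, hα', hβ'⟩ := hex α hα β hβA i hi
  have hij : i ≠ j := by rintro rfl; omega
  -- If `i` precedes `j`, the exchanged `α` is lexicographically smaller. Otherwise `j` lies in `I`,
  -- so the exchanged `β` has the same sum over `I` but is closer to `α`.
  by_cases hlt' : τ.symm i < τ.symm j
  · refine absurd (hmin _ hα') (not_le.2 ?_)
    refine ⟨τ.symm i, fun l hl => ?_, ?_⟩
    · have h1 : τ l ≠ i := by rintro rfl; simp at hl
      have h2 : τ l ≠ j := by
        rintro rfl
        simp only [Equiv.symm_apply_apply] at hlt'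
        exact absurd hl hlt'.asymm
      simp [h1, h2]
    · simp [hij]
  · have hjI : j ∈ I := hI i hiI j
      (lt_of_le_of_ne (not_lt.1 hlt') (fun h => hij (τ.symm.injective h.symm)))
    rw [move_comm] at hβ'
    refine absurd (hβmin _ ⟨hβ', ?_⟩) (not_le.2 ?_)
    · rw [sum_move]; simpa [hiI, hjI] using hlt
    · refine Finset.sum_lt_sum (fun l _ => ?_) ⟨i, Finset.mem_univ _, ?_⟩
      · simp only [Pi.add_apply, Pi.sub_apply, Pi.single_apply]
        rcases eq_or_ne l i with rfl | h1
        · simp only [if_true, if_neg hij]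
          rw [abs_of_nonneg (by omega), abs_of_nonneg (by omega)]; omega
        · rcases eq_or_ne l j with rfl | h2
          · simp only [if_true, if_neg h1]
            rw [abs_of_nonpos (by omega), abs_of_nonpos (by omega)]; omega
          · simp [h1, h2]
      · simp only [Pi.add_apply, Pi.sub_apply, Pi.single_apply, if_true, if_neg hij]
        rw [abs_of_nonneg (by omega), abs_of_nonneg (by omega)]; omega

/-- Abel summation: an antitone weight against a sequence with nonnegative partial sums. -/
theorem mul_sum_le_sum_mul_of_antitone {m : ℕ} (f d : Fin (m + 1) → ℝ) (hf : Antitone f)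
    (hd : ∀ k : Fin (m + 1), 0 ≤ ∑ i with i ≤ k, d i) :
    f (Fin.last m) * ∑ i, d i ≤ ∑ i, f i * d i := by
  induction m with
  | zero => simp
  | succ m ih =>
    have key : ∀ k : Fin (m + 1), ∑ i with i ≤ k.castSucc, d i =
        ∑ i with i ≤ k, d (Fin.castSucc i) := by
      intro k
      rw [Finset.sum_filter, Fin.sum_univ_castSucc, Finset.sum_filter]
      simp only [Fin.castSucc_le_castSucc_iff]
      rw [if_neg (not_le.2 (Fin.castSucc_lt_last k)), add_zero]
    have := ih (fun i => f i.castSucc) (fun i => d i.castSucc)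
      (fun a b h => hf (by simpa using h)) (fun k => by rw [← key]; exact hd _)
    have h0 : 0 ≤ ∑ i, d (Fin.castSucc i) := by
      have := hd (Fin.last m).castSucc
      rw [key] at this
      simpa [Fin.le_last] using this
    have h1 : f (Fin.last (m + 1)) ≤ f (Fin.last m).castSucc := hf (Fin.le_last _)
    rw [Fin.sum_univ_castSucc d, Fin.sum_univ_castSucc fun i => f i * d i]
    nlinarith [mul_le_mul_of_nonneg_right h1 h0]

theorem convex_permutahedronOf {n : ℕ} (z : Finset (Fin n) → ℝ) :
    Convex ℝ (permutahedronOf z) := by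
  intro x hx y hy a b ha hb hab
  have hs : ∀ I : Finset (Fin n), ∑ i ∈ I, (a • x + b • y) i =
      a * ∑ i ∈ I, x i + b * ∑ i ∈ I, y i := fun I => by
    simp [Finset.sum_add_distrib, Finset.mul_sum]
  refine ⟨fun I hI => ?_, ?_⟩
  · rw [hs]
    have h1 := mul_le_mul_of_nonneg_left (hx.1 I hI) ha
    have h2 := mul_le_mul_of_nonneg_left (hy.1 I hI) hb
    have : z I = a * z I + b * z I := by rw [← add_mul, hab, one_mul]
    linarith
  · rw [hs, hx.2, hy.2, ← add_mul, hab, one_mul]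

/-- A linear functional on a vector whose partial sums along a decreasing order of the weights are
nonnegative. -/
theorem sum_mul_nonneg_of_initial {n : ℕ} (w d : Fin n → ℝ) (τ : Equiv.Perm (Fin n))
    (hw : Antitone (w ∘ τ)) (h0 : ∑ i, d i = 0)
    (hd : ∀ I : Finset (Fin n), (∀ i ∈ I, ∀ j, τ.symm j < τ.symm i → j ∈ I) → 0 ≤ ∑ i ∈ I, d i) :
    0 ≤ ∑ i, w i * d i := by
  rcases n with _ | m
  · simp
  have := mul_sum_le_sum_mul_of_antitone (w ∘ τ) (d ∘ τ) hw (fun k => by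
    have h := hd ((Finset.univ.filter fun i => i ≤ k).map τ.toEmbedding) (by
      intro i hi j hj
      simp only [Finset.mem_map_equiv, Finset.mem_filter, Finset.mem_univ, true_and] at hi ⊢
      exact hj.le.trans hi)
    rw [Finset.sum_map] at h
    exact h)
  have e1 : ∑ i, (d ∘ τ) i = 0 := by rw [← h0]; exact Equiv.sum_comp τ d
  have e2 : ∑ i, (w ∘ τ) i * (d ∘ τ) i = ∑ i, w i * d i :=
    Equiv.sum_comp τ (fun i => w i * d i)
  rw [e1, e2, mul_zero] at this
  exact this

/-- The convex hull of a finite set of integer vectors with the symmetric exchange property is a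
generalized permutahedron. -/
theorem SymmetricExchange.isGeneralizedPermutahedron {n : ℕ} {A : Finset (Fin n → ℤ)}
    (hA : A.Nonempty) (hex : SymmetricExchange A) {s : ℤ} (hs : ∀ α ∈ A, ∑ i, α i = s) :
    IsGeneralizedPermutahedron
      (convexHull ℝ ((fun (α : Fin n → ℤ) (i : Fin n) => (α i : ℝ)) '' (A : Set (Fin n → ℤ)))) := by
  set z : Finset (Fin n) → ℤ := fun I => A.inf' hA fun α => ∑ i ∈ I, α i with hz
  have hzle : ∀ I, ∀ α ∈ A, z I ≤ ∑ i ∈ I, α i := fun I α hα =>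
    Finset.inf'_le (fun α : Fin n → ℤ => ∑ i ∈ I, α i) hα
  have hzeq : ∀ I, ∀ α ∈ A, (∀ β ∈ A, ∑ i ∈ I, α i ≤ ∑ i ∈ I, β i) → z I = ∑ i ∈ I, α i :=
    fun I α hα h => le_antisymm (hzle I α hα) (Finset.le_inf' _ _ h)
  have hzuniv : z Finset.univ = s := by
    obtain ⟨α, hα⟩ := hA
    rw [hzeq _ α hα (fun β hβ => by rw [hs α hα, hs β hβ]), hs α hα]
  refine ⟨fun I => (z I : ℝ), ?_, fun I J => ?_, ?_⟩
  · obtain ⟨α, hα⟩ := hA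
    simp [hzeq ∅ α hα (by simp)]
  -- In an order that lists `I ∩ J` first and then the rest of `I ∪ J`, one greedy vector attains
  -- both minima. Its coordinate sums are modular, and its sums over `I` and `J` are at least `z I`
  -- and `z J`.
  · set g : Fin n → ℕ := fun i => if i ∈ I ∩ J then 0 else if i ∈ I ∪ J then 1 else 2 with hg
    obtain ⟨α, hα, hmin⟩ := hex.exists_greedy hA (Tuple.sort g)
    have hmono := Tuple.monotone_sort g
    have hini : ∀ (K : Finset (Fin n)) (c : ℕ), (∀ i, i ∈ K ↔ g i ≤ c) →
        z K = ∑ i ∈ K, α i := fun K c hK => hzeq K α hα (hmin K (by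
      intro i hi j hj
      rw [hK] at hi ⊢
      have := hmono hj.le
      simp only [Function.comp_apply, Equiv.apply_symm_apply] at this
      omega))
    have h1 := hini (I ∩ J) 0 (fun i => by simp only [hg]; split_ifs <;> simp_all)
    have h2 := hini (I ∪ J) 1 (fun i => by
      simp only [hg, Finset.mem_inter, Finset.mem_union]; split_ifs <;> simp_all)
    have h3 := hzle I α hα
    have h4 := hzle J α hα
    have h5 := Finset.sum_union_inter (s₁ := I) (s₂ := J) (f := α)
    have : z I + z J ≤ z (I ∪ J) + z (I ∩ J) := by omega
    show (z I : ℝ) + z J ≤ z (I ∪ J) + z (I ∩ J)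
    exact_mod_cast this
  · apply Set.Subset.antisymm
    · refine convexHull_min ?_ (convex_permutahedronOf _)
      rintro _ ⟨α, hα, rfl⟩
      refine ⟨fun I _ => ?_, ?_⟩
      · show (z I : ℝ) ≤ ∑ i ∈ I, (α i : ℝ)
        exact_mod_cast hzle I α hα
      · show ∑ i, (α i : ℝ) = (z Finset.univ : ℝ)
        rw [hzuniv, ← hs α hα]; push_cast; rfl
    · intro t ht
      by_contra hnot
      -- Separate `t` from the hull by a functional with weights `w`. The greedy vector for the
      -- order of decreasing weights has partial sums no larger than those of `t`, so Abel summation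
      -- gives it a functional value at most `f t`, against the separation.
      obtain ⟨f, u, hfu, hfb⟩ := geometric_hahn_banach_point_closed (convex_convexHull ℝ _)
        (((Finset.finite_toSet A).image _).isClosed_convexHull (𝕜 := ℝ)) hnot
      set w : Fin n → ℝ := fun i => f (Pi.single i 1) with hw
      have hf : ∀ x, f x = ∑ i, w i * x i := fun x => by
        have := LinearMap.pi_apply_eq_sum_univ (f : (Fin n → ℝ) →ₗ[ℝ] ℝ) x
        simp only [ContinuousLinearMap.coe_coe, smul_eq_mul] at this
        rw [this]
        refine Finset.sum_congr rfl fun i _ => ?_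
        rw [mul_comm, hw]
        congr 2
        ext j
        simp [Pi.single_apply, eq_comm]
      have hmono := Tuple.monotone_sort (fun i => -w i)
      set τ := Tuple.sort (fun i => -w i)
      obtain ⟨α, hα, hmin⟩ := hex.exists_greedy hA τ
      have h1 := hfb _ (subset_convexHull ℝ _ ⟨α, hα, rfl⟩)
      have h2 := sum_mul_nonneg_of_initial w (fun i => t i - α i) τ
        (fun a b h => by simpa using hmono h)
        (by
          have := ht.2
          simp only [hzuniv, ← hs α hα] at this
          rw [Finset.sum_sub_distrib, this]; push_cast; simp)
        (by
          intro I hI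
          rw [Finset.sum_sub_distrib, sub_nonneg]
          have hzI := hzeq I α hα (hmin I hI)
          have : (z I : ℝ) = ∑ i ∈ I, (α i : ℝ) := by rw [hzI]; push_cast; rfl
          rw [← this]
          by_cases hu : I = Finset.univ
          · subst hu; exact ht.2.ge
          · exact ht.1 I hu)
      rw [hf] at h1 hfu
      simp only [mul_sub, Finset.sum_sub_distrib] at h2
      linarith

/-! ### The exchange property of a box with a chain of prefix bounds. -/

/-- The integer vectors of given sum whose coordinates and initial partial sums are bounded above
have the symmetric exchange property. -/
theorem symmetricExchange_of_box_chain {n : ℕ} {A : Finset (Fin n → ℤ)} (u : Fin n → ℤ)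
    (c : ℕ → ℤ) (s : ℤ)
    (hA : ∀ α, α ∈ A ↔ (∀ i, α i ≤ u i) ∧ (∀ k < n, ∑ i with i.val < k, α i ≤ c k) ∧
      ∑ i, α i = s) :
    SymmetricExchange A := by
  intro α hα β hβ i hi
  set P : (Fin n → ℤ) → ℕ → ℤ := fun γ k => ∑ i with i.val < k, γ i with hP
  have hP0 : ∀ γ, P γ 0 = 0 := fun γ => by simp [hP]
  have hPs : ∀ γ (l : Fin n), P γ (l + 1) = P γ l + γ l := fun γ l => by
    have : (Finset.univ.filter fun j : Fin n => j.val < l + 1) =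
        insert l (Finset.univ.filter fun j : Fin n => j.val < l) := by
      ext j; simp [Fin.ext_iff]; omega
    simp only [hP, this]
    rw [Finset.sum_insert (by simp), add_comm]
  have hPn : ∀ γ, P γ n = ∑ i, γ i := fun γ => by simp [hP]
  have hα' := (hA α).1 hα
  have hβ' := (hA β).1 hβ
  -- Moving a unit from `a` to `b` raises only the prefix sums that contain `b` but not `a`, so only
  -- these need slack.
  have hmove : ∀ γ ∈ A, ∀ a b : Fin n, a ≠ b → γ b < u b →
      (∀ k, b.val < k → k ≤ a.val → P γ k < c k) → γ - Pi.single a 1 + Pi.single b 1 ∈ A := by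
    intro γ hγ a b hab hb hk
    have hγ' := (hA γ).1 hγ
    refine (hA _).2 ⟨fun l => ?_, fun k hkn => ?_, ?_⟩
    · have := hγ'.1 l
      simp only [Pi.add_apply, Pi.sub_apply, Pi.single_apply]
      by_cases h1 : l = a <;> by_cases h2 : l = b <;> simp [h1, h2] <;> subst_vars <;> omega
    · rw [sum_move]
      have := hγ'.2.1 k hkn
      have h3 := hk k
      simp only [hP] at h3
      simp only [Finset.mem_filter, Finset.mem_univ, true_and]
      split_ifs <;> omega
    · rw [sum_move]; simp [hγ'.2.2]
  by_cases hL : ∃ j : Fin n, j < i ∧ α j < β j ∧ ∀ k, j.val < k → k ≤ i.val → P α k < c k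
  · obtain ⟨j, hji, hj, hk⟩ := hL
    refine ⟨j, hj, ?_, ?_⟩
    · exact hmove α hα i j (by omega) (by have := hβ'.1 j; omega) hk
    · rw [move_comm]
      exact hmove β hβ j i (by omega) (by have := hα'.1 i; omega)
        (fun k h1 h2 => by simp only [Fin.lt_def] at hji; omega)
  by_cases hR : ∃ j : Fin n, i < j ∧ α j < β j ∧ ∀ k, i.val < k → k ≤ j.val → P β k < c k
  · obtain ⟨j, hij, hj, hk⟩ := hR
    refine ⟨j, hj, ?_, ?_⟩
    · exact hmove α hα i j (by omega) (by have := hβ'.1 j; omega)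
        (fun k h1 h2 => by simp only [Fin.lt_def] at hij; omega)
    · rw [move_comm]
      exact hmove β hβ j i (by omega) (by have := hα'.1 i; omega) hk
  exfalso
  push Not at hL hR
  -- If `α` had the smaller prefix sum at `i`, this strict inequality would give slack there. The
  -- absence of an exchange partner on the left would then carry it down to the empty prefix, where
  -- both sums vanish.
  have h1 : P β i ≤ P α i := by
    by_contra! hlt
    have key : ∀ e ≤ i.val, P α (i.val - e) < P β (i.val - e) ∧
        ∀ k, i.val - e ≤ k → k ≤ i.val → P α k < c k := by
      intro e
      induction e with
      | zero =>
        refine fun _ => ⟨hlt, fun k h1 h2 => ?_⟩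
        obtain rfl : k = i.val := by omega
        exact hlt.trans_le (hβ'.2.1 _ i.2)
      | succ e ih =>
        intro he
        obtain ⟨ih1, ih2⟩ := ih (by omega)
        let l : Fin n := ⟨i.val - (e + 1), by omega⟩
        have hl : i.val - e = l.val + 1 := by simp only [l]; omega
        rw [hl, hPs, hPs] at ih1
        have hl2 : β l ≤ α l := by
          by_contra! h
          obtain ⟨k, h1, h2, h3⟩ := hL l (by simp only [Fin.lt_def, l]; omega) h
          exact absurd (ih2 k (by omega) h2) (by omega)
        have hl3 : P α l < P β l := by omega
        refine ⟨hl3, fun k h1 h2 => ?_⟩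
        rcases eq_or_ne k l.val with rfl | h
        · exact hl3.trans_le (hβ'.2.1 _ l.2)
        · exact ih2 k (by simp only [l] at h; omega) h2
    have := (key i.val le_rfl).1
    simp [hP0] at this
  -- To the right of `i` the inequality is reversed and spreads in the same way, up to the full
  -- sums, which are equal.
  have key : ∀ m, i.val + 1 ≤ m → m ≤ n →
      P β m < P α m ∧ ∀ k, i.val < k → k ≤ m → k < n → P β k < c k := by
    intro m hm
    induction m, hm using Nat.le_induction with
    | base =>
      intro hn
      have h2 : P β (i + 1) < P α (i + 1) := by rw [hPs, hPs]; omega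
      refine ⟨h2, fun k h3 h4 h5 => ?_⟩
      obtain rfl : k = i.val + 1 := by omega
      exact h2.trans_le (hα'.2.1 _ h5)
    | succ m hm ih =>
      intro hmn
      obtain ⟨ih1, ih2⟩ := ih (by omega)
      let l : Fin n := ⟨m, by omega⟩
      have hl2 : β l ≤ α l := by
        by_contra! h
        obtain ⟨k, h1, h2, h3⟩ := hR l (by simp only [Fin.lt_def, l]; omega) h
        exact absurd (ih2 k h1 h2 (by simp only [l] at h2; omega)) (by omega)
      have h2 : P β (m + 1) < P α (m + 1) := by
        have e1 := hPs α l
        have e2 := hPs β l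
        simp only [l] at e1 e2 hl2
        omega
      refine ⟨h2, fun k h3 h4 h5 => ?_⟩
      rcases eq_or_ne k (m + 1) with rfl | h
      · exact h2.trans_le (hα'.2.1 _ h5)
      · exact ih2 k h3 (by omega) h5
  have := (key n i.2 le_rfl).1
  rw [hPn, hPn, hα'.2.2, hβ'.2.2] at this
  exact lt_irrefl _ this

/-! ### Lehmer codes, inversions and reduced tilings. -/

/-- The Lehmer code of a permutation. -/
def lehmerCode {m : ℕ} (σ : Equiv.Perm (Fin m)) (i : Fin m) : ℕ :=
  (Finset.univ.filter fun b => i < b ∧ σ b < σ i).card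

/-- The number of inversions of a permutation. -/
def inversionNumber {m : ℕ} (σ : Equiv.Perm (Fin m)) : ℕ :=
  ∑ i, lehmerCode σ i

/-- The adjacent transposition that interchanges the positions `k` and `k + 1`. -/
abbrev adjSwap {n : ℕ} (k : Fin n) : Equiv.Perm (Fin (n + 1)) :=
  Equiv.swap k.castSucc k.succ

theorem adjSwap_of_ne {n : ℕ} {k : Fin n} {i : Fin (n + 1)} (h1 : i ≠ k.castSucc)
    (h2 : i ≠ k.succ) : adjSwap k i = i :=
  Equiv.swap_apply_of_ne_of_ne h1 h2

theorem val_adjSwap {n : ℕ} (k : Fin n) (x : Fin (n + 1)) :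
    (adjSwap k x : ℕ) = if (x : ℕ) = k then (k : ℕ) + 1 else if (x : ℕ) = k + 1 then k else x := by
  rw [adjSwap, Equiv.swap_apply_def]
  simp only [Fin.ext_iff, Fin.val_castSucc, Fin.val_succ]
  split_ifs <;> simp

theorem adjSwap_lt_adjSwap {n : ℕ} {k : Fin n} {x y : Fin (n + 1)} (hxy : x < y)
    (h : ¬ (x = k.castSucc ∧ y = k.succ)) : adjSwap k x < adjSwap k y := by
  rw [Fin.lt_def, val_adjSwap, val_adjSwap]
  simp only [Fin.ext_iff, Fin.lt_def, Fin.val_castSucc, Fin.val_succ] at *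
  split_ifs <;> omega

/-- The swap changes the relative order of positions only for the pair `k`, `k + 1`; at an ascent
this pair becomes one new inversion, counted at its left position. -/
theorem lehmerCode_mul_adjSwap {n : ℕ} (σ : Equiv.Perm (Fin (n + 1))) (k : Fin n)
    (h : σ k.castSucc < σ k.succ) (i : Fin (n + 1)) :
    lehmerCode (σ * adjSwap k) i =
      lehmerCode σ (adjSwap k i) + if i = k.castSucc then 1 else 0 := by
  have hne : k.castSucc ≠ k.succ := (Fin.castSucc_lt_succ).ne
  have e1 : lehmerCode (σ * adjSwap k) i =
      (Finset.univ.filter fun b => i < adjSwap k b ∧ σ b < σ (adjSwap k i)).card := by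
    unfold lehmerCode
    refine Finset.card_equiv (adjSwap k) fun b => ?_
    rw [Finset.mem_filter, Finset.mem_filter]
    simp [adjSwap]
  rw [e1]
  unfold lehmerCode
  split_ifs with hi
  · subst hi
    rw [← Finset.card_insert_of_notMem (a := k.castSucc)]
    · congr 1
      ext b
      simp only [Finset.mem_filter, Finset.mem_univ, true_and, Finset.mem_insert, adjSwap,
        Equiv.swap_apply_left]
      by_cases h1 : b = k.castSucc
      · subst h1; simp [h]
      by_cases h2 : b = k.succ
      · subst h2; simp [hne.symm]
      rw [Equiv.swap_apply_of_ne_of_ne h1 h2]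
      simp only [h1, false_or, and_congr_left_iff]
      intro _
      simp only [Fin.ext_iff, Fin.lt_def, Fin.val_castSucc, Fin.val_succ] at *
      omega
    · intro hmem
      have := (Finset.mem_filter.1 hmem).2.1
      rw [adjSwap, Equiv.swap_apply_left] at this
      exact this.asymm Fin.castSucc_lt_succ
  · rw [add_zero]
    congr 1
    ext b
    simp only [Finset.mem_filter, Finset.mem_univ, true_and]
    by_cases hi2 : i = k.succ
    · subst hi2
      simp only [adjSwap, Equiv.swap_apply_right]
      by_cases h1 : b = k.castSucc
      · subst h1; simp
      by_cases h2 : b = k.succ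
      · subst h2; simp [h.le]
      rw [Equiv.swap_apply_of_ne_of_ne h1 h2]
      simp only [and_congr_left_iff]
      intro _
      simp only [Fin.ext_iff, Fin.lt_def, Fin.val_castSucc, Fin.val_succ] at *
      omega
    · rw [adjSwap_of_ne hi hi2]
      simp only [and_congr_left_iff]
      intro _
      by_cases h1 : b = k.castSucc
      · subst h1
        simp only [adjSwap, Equiv.swap_apply_left, Fin.ext_iff, Fin.lt_def, Fin.val_castSucc,
          Fin.val_succ] at *
        omega
      by_cases h2 : b = k.succ
      · subst h2
        simp only [adjSwap, Equiv.swap_apply_right, Fin.ext_iff, Fin.lt_def, Fin.val_castSucc,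
          Fin.val_succ] at *
        omega
      rw [adjSwap_of_ne h1 h2]

theorem inversionNumber_mul_adjSwap {n : ℕ} (σ : Equiv.Perm (Fin (n + 1))) (k : Fin n)
    (h : σ k.castSucc < σ k.succ) :
    inversionNumber (σ * adjSwap k) = inversionNumber σ + 1 := by
  unfold inversionNumber
  simp only [lehmerCode_mul_adjSwap σ k h, Finset.sum_add_distrib, Finset.sum_ite_eq',
    Finset.mem_univ, if_true]
  rw [Equiv.sum_comp (adjSwap k) (lehmerCode σ)]

/-- The Demazure product of a permutation with an adjacent transposition. -/
def demazureStep {n : ℕ} (k : Fin n) (σ : Equiv.Perm (Fin (n + 1))) : Equiv.Perm (Fin (n + 1)) :=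
  if σ k.castSucc < σ k.succ then σ * adjSwap k else σ

/-- The number of the antidiagonal of a tile. -/
def Tile.diagonal {n : ℕ} (c : Tile n) : Fin n := ⟨(c.1.1 : ℕ) + (c.1.2 : ℕ), c.2⟩

/-- A cross either adds exactly one inversion or is ignored. Equality therefore means that no cross
is ignored. -/
theorem inversionNumber_foldl_passCross {n : ℕ} (l : List (Tile n)) :
    ∀ σ : Equiv.Perm (Fin (n + 1)),
      inversionNumber (l.foldl passCross σ) ≤ inversionNumber σ + l.length ∧
      (NoSecondCrossing l σ ↔
        inversionNumber (l.foldl passCross σ) = inversionNumber σ + l.length) := by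
  induction l with
  | nil => intro σ; simp [NoSecondCrossing]
  | cons c l ih =>
    intro σ
    obtain ⟨h1, h2⟩ := ih (passCross σ c)
    simp only [List.foldl_cons, NoSecondCrossing, List.length_cons, h2]
    by_cases h : σ (topEdge c) < σ (rightEdge c)
    · have : inversionNumber (passCross σ c) = inversionNumber σ + 1 := by
        rw [passCross, if_pos h]
        exact inversionNumber_mul_adjSwap σ (Tile.diagonal c) h
      simp only [h, true_and]
      omega
    · have : passCross σ c = σ := by rw [passCross, if_neg h]
      rw [this] at h1 ⊢
      simp only [h, false_and, false_iff]
      omega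

theorem mem_tileList {n : ℕ} (c : Tile n) : c ∈ tileList n := by
  obtain ⟨⟨i, j⟩, h⟩ := c
  simp only [tileList, List.mem_flatMap, List.mem_finRange, true_and, List.mem_filterMap,
    List.mem_reverse]
  exact ⟨i, j, by rw [dif_pos h]⟩

theorem nodup_tileList (n : ℕ) : (tileList n).Nodup := by
  rw [tileList, List.nodup_flatMap]
  constructor
  · intro i _
    refine List.Nodup.filterMap ?_ (List.nodup_reverse.2 (List.nodup_finRange n))
    intro a a' b hb hb'
    simp only [Option.mem_def, Option.dite_none_right_eq_some, Option.some.injEq] at hb hb'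
    obtain ⟨_, hb⟩ := hb
    obtain ⟨_, hb'⟩ := hb'
    rw [← hb'] at hb
    simpa using hb
  · refine (List.nodup_finRange n).imp fun {i i'} hne => ?_
    intro c hc hc'
    simp only [List.mem_filterMap, Option.dite_none_right_eq_some, Option.some.injEq] at hc hc'
    obtain ⟨_, _, _, hc⟩ := hc
    obtain ⟨_, _, _, hc'⟩ := hc'
    rw [← hc'] at hc
    simp at hc
    exact hne hc.1

theorem length_crossList {n : ℕ} (D : Finset (Tile n)) : (crossList D).length = D.card := by
  have h : (crossList D).toFinset = D := by
    ext c; simp [crossList, mem_tileList]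
  have hn : (crossList D).Nodup := (nodup_tileList n).filter _
  rw [← List.toFinset_card_of_nodup hn, h]

theorem inversionNumber_one (m : ℕ) : inversionNumber (1 : Equiv.Perm (Fin m)) = 0 := by
  simp only [inversionNumber, lehmerCode, Finset.sum_eq_zero_iff, Finset.card_eq_zero]
  intro i _
  refine Finset.filter_eq_empty_iff.2 fun b _ h => ?_
  exact h.1.asymm h.2

theorem inversionNumber_strandPerm_le {n : ℕ} (D : Finset (Tile n)) :
    inversionNumber (strandPerm D) ≤ D.card := by
  have := (inversionNumber_foldl_passCross (crossList D) 1).1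
  rwa [inversionNumber_one, zero_add, length_crossList] at this

theorem isReducedTiling_iff {n : ℕ} (D : Finset (Tile n)) :
    IsReducedTiling D ↔ D.card = inversionNumber (strandPerm D) := by
  have := (inversionNumber_foldl_passCross (crossList D) 1).2
  rw [inversionNumber_one, zero_add, length_crossList] at this
  rw [IsReducedTiling, this, eq_comm]
  rfl

/-! ### 132-avoiding permutations and the longest permutation. -/

/-- Avoidance of the pattern 132. -/
def Avoids132 {m : ℕ} (σ : Equiv.Perm (Fin m)) : Prop :=
  ∀ a b c, a < b → b < c → σ a < σ c → ¬ σ c < σ b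

/-- A pattern 132 at `a < b < c` puts the cell `(b, σ c)` into the diagram. A lower set would then
contain `(a, σ a)`, which never belongs to a diagram. -/
theorem IsDominantPerm.avoids132 {m : ℕ} {σ : Equiv.Perm (Fin m)} (h : IsDominantPerm σ) :
    Avoids132 σ := by
  intro a b c hab hbc hac hcb
  have h1 : (b, σ c) ∈ rotheDiagram σ := ⟨hcb, by simpa using hbc⟩
  have h2 : (a, σ a) ∈ rotheDiagram σ := h (⟨hab.le, hac.le⟩ : (a, σ a) ≤ (b, σ c)) h1
  exact lt_irrefl _ h2.1

theorem Avoids132.lehmerCode_le {m : ℕ} {σ : Equiv.Perm (Fin m)} (h : Avoids132 σ) {i j : Fin m}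
    (hij : i < j) : lehmerCode σ j ≤ lehmerCode σ i := by
  refine Finset.card_le_card fun b hb => ?_
  simp only [Finset.mem_filter, Finset.mem_univ, true_and] at hb ⊢
  refine ⟨hij.trans hb.1, ?_⟩
  by_contra hcon
  have hne : σ i ≠ σ b := fun e => (hij.trans hb.1).ne (σ.injective e)
  exact h i j b hij hb.1 (lt_of_le_of_ne (not_lt.1 hcon) hne) hb.2

theorem Avoids132.lehmerCode_eq {n : ℕ} {σ : Equiv.Perm (Fin (n + 1))} (h : Avoids132 σ)
    {k : Fin n} (hk : σ k.castSucc < σ k.succ) :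
    lehmerCode σ k.castSucc = lehmerCode σ k.succ := by
  refine le_antisymm (Finset.card_le_card fun b hb => ?_)
    (h.lehmerCode_le Fin.castSucc_lt_succ)
  simp only [Finset.mem_filter, Finset.mem_univ, true_and] at hb ⊢
  have hne : ¬ b = k.succ := by rintro rfl; exact hb.2.asymm hk
  refine ⟨?_, hb.2.trans hk⟩
  have := hb.1
  simp only [Fin.ext_iff, Fin.lt_def, Fin.val_castSucc, Fin.val_succ] at *
  omega

/-- Interchanging the entries at the first ascent preserves 132-avoidance. -/
theorem Avoids132.mul_adjSwap {n : ℕ} {σ : Equiv.Perm (Fin (n + 1))} (h : Avoids132 σ)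
    {k : Fin n} (hk : σ k.castSucc < σ k.succ)
    (hfirst : ∀ j : Fin n, j < k → σ j.succ < σ j.castSucc) : Avoids132 (σ * adjSwap k) := by
  -- Before the first ascent the entries decrease, so none of them can be the smallest entry of a
  -- pattern that ends in the swapped pair.
  have hdesc : ∀ a : Fin (n + 1), a < k.castSucc → σ k.castSucc < σ a := by
    intro a ha
    have key : ∀ d : ℕ, ∀ b : Fin (n + 1), b.val + d + 1 = k.val → σ k.castSucc < σ b := by
      intro d
      induction d with
      | zero =>
        intro b hb
        have := hfirst ⟨b.val, by omega⟩ (by simp only [Fin.lt_def]; omega)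
        have e : k.castSucc = Fin.succ ⟨b.val, by omega⟩ := by ext; simp; omega
        rw [e]
        exact this
      | succ d ih =>
        intro b hb
        have h1 := hfirst ⟨b.val, by omega⟩ (by simp only [Fin.lt_def]; omega)
        have h2 := ih ⟨b.val + 1, by omega⟩ (by simp; omega)
        exact h2.trans h1
    simp only [Fin.lt_def, Fin.val_castSucc] at ha
    exact key (k.val - a.val - 1) a (by omega)
  intro a b c hab hbc hac hcb
  simp only [Equiv.Perm.mul_apply] at hac hcb
  by_cases h1 : a = k.castSucc ∧ b = k.succ
  · obtain ⟨rfl, rfl⟩ := h1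
    simp only [adjSwap, Equiv.swap_apply_left, Equiv.swap_apply_right] at hac hcb
    exact (hac.trans (hcb.trans hk)).false
  by_cases h2 : b = k.castSucc ∧ c = k.succ
  · obtain ⟨rfl, rfl⟩ := h2
    simp only [adjSwap, Equiv.swap_apply_right] at hac
    rw [Equiv.swap_apply_of_ne_of_ne hab.ne (hab.trans hbc).ne] at hac
    exact (hac.trans (hdesc a hab)).false
  exact h _ _ _ (adjSwap_lt_adjSwap hab h1) (adjSwap_lt_adjSwap hbc h2) hac hcb

theorem lehmerCode_of_descending {n : ℕ} {σ : Equiv.Perm (Fin (n + 1))}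
    (h : ∀ k : Fin n, σ k.succ < σ k.castSucc) (i : Fin (n + 1)) : lehmerCode σ i = n - i := by
  have hanti : StrictAnti σ := Fin.strictAnti_iff_succ_lt.2 h
  have : (Finset.univ.filter fun b => i < b ∧ σ b < σ i) = Finset.Ioi i := by
    ext b
    simp only [Finset.mem_filter, Finset.mem_univ, true_and, Finset.mem_Ioi, and_iff_left_iff_imp]
    exact fun hb => hanti hb
  rw [lehmerCode, this, Fin.card_Ioi]
  omega

/-- The tiles, row by row. -/
def tileEquivSigma (n : ℕ) : Tile n ≃ Σ i : Fin n, Fin (n - i) where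
  toFun c := ⟨c.1.1, ⟨c.1.2, by have := c.2; omega⟩⟩
  invFun s := ⟨(s.1, ⟨s.2, by omega⟩), by have := s.2.2; simp; omega⟩
  left_inv _ := rfl
  right_inv _ := rfl

theorem card_tile (n : ℕ) : Fintype.card (Tile n) = ∑ i : Fin n, (n - i) := by
  rw [Fintype.card_congr (tileEquivSigma n), Fintype.card_sigma]
  simp

/-- The longest permutation has as many inversions as there are tiles, and a tiling has at least as
many crosses as its permutation has inversions. -/
theorem eq_univ_of_strandPerm_descending {n : ℕ} {D : Finset (Tile n)}
    (h : ∀ k : Fin n, strandPerm D k.succ < strandPerm D k.castSucc) : D = Finset.univ := by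
  rw [← Finset.card_eq_iff_eq_univ]
  refine le_antisymm (Finset.card_le_univ D) ?_
  have := inversionNumber_strandPerm_le D
  rw [inversionNumber, Fin.sum_univ_castSucc] at this
  simp only [lehmerCode_of_descending h] at this
  rw [card_tile]
  simpa using this

/-! ### Moving the smallest entry from the front to the back. -/

section MoveZero

variable {n : ℕ}

/-- Move the entry at position `0` to the position `k`, shifting the entries in between. -/
def shiftFirst (π : Equiv.Perm (Fin (n + 1))) : ℕ → Equiv.Perm (Fin (n + 1))
  | 0 => π
  | k + 1 => if h : k < n then shiftFirst π k * adjSwap ⟨k, h⟩ else shiftFirst π k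

theorem shiftFirst_succ (π : Equiv.Perm (Fin (n + 1))) (k : Fin n) :
    shiftFirst π (k + 1) = shiftFirst π k * adjSwap k := by
  simp [shiftFirst]

theorem shiftFirst_apply (π : Equiv.Perm (Fin (n + 1))) (k : ℕ) (hk : k ≤ n) :
    (∀ j : Fin n, j.val < k → shiftFirst π k j.castSucc = π j.succ) ∧
    shiftFirst π k ⟨k, by omega⟩ = π 0 ∧
    (∀ j : Fin (n + 1), k < j.val → shiftFirst π k j = π j) := by
  induction k with
  | zero => exact ⟨by simp, rfl, fun _ _ => rfl⟩
  | succ k ih =>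
    obtain ⟨h1, h2, h3⟩ := ih (by omega)
    have e := shiftFirst_succ π ⟨k, by omega⟩
    simp only at e
    refine ⟨fun j hj => ?_, ?_, fun j hj => ?_⟩
    · rw [e, Equiv.Perm.mul_apply]
      rcases Nat.lt_succ_iff_lt_or_eq.1 hj with hj | hj
      · rw [adjSwap_of_ne (by simp [Fin.ext_iff]; omega) (by simp [Fin.ext_iff]; omega), h1 j hj]
      · subst hj
        rw [adjSwap, Equiv.swap_apply_left, h3 _ (by simp)]
    · rw [e, Equiv.Perm.mul_apply]
      have : (⟨k + 1, by omega⟩ : Fin (n + 1)) = Fin.succ ⟨k, by omega⟩ := rfl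
      rw [this, adjSwap, Equiv.swap_apply_right]
      exact h2
    · rw [e, Equiv.Perm.mul_apply, adjSwap_of_ne (by simp [Fin.ext_iff]; omega)
        (by simp [Fin.ext_iff]; omega), h3 j (by omega)]

/-- The Lehmer code of a permutation, without its first entry and continued by zeros. -/
def tailCode (π : Equiv.Perm (Fin (n + 1))) (i : ℕ) : ℕ :=
  if h : i < n then lehmerCode π (Fin.succ ⟨i, h⟩) else 0

theorem shiftFirst_lt (π : Equiv.Perm (Fin (n + 1))) (h0 : π 0 = 0) (k : Fin n) :
    shiftFirst π k k.castSucc < shiftFirst π k k.succ := by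
  obtain ⟨_, h2, h3⟩ := shiftFirst_apply π k k.2.le
  have e : (k.castSucc : Fin (n + 1)) = ⟨k, by omega⟩ := rfl
  rw [e, h2, h3 _ (by simp), h0]
  refine Fin.pos_iff_ne_zero.2 fun h => ?_
  rw [← h0] at h
  exact Fin.succ_ne_zero k (π.injective h)

theorem lehmerCode_eq_zero_of_apply_eq_zero (π : Equiv.Perm (Fin (n + 1))) {i : Fin (n + 1)}
    (h : π i = 0) : lehmerCode π i = 0 := by
  simp [lehmerCode, h]

/-- Each entry that the minimum jumps over moves one place to the left and gains one inversion, with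
the minimum itself. -/
theorem lehmerCode_shiftFirst (π : Equiv.Perm (Fin (n + 1))) (h0 : π 0 = 0) (k : ℕ) (hk : k ≤ n)
    (i : Fin (n + 1)) :
    lehmerCode (shiftFirst π k) i =
      if i.val < k then tailCode π i + 1 else if i.val = k then 0 else tailCode π (i - 1) := by
  induction k generalizing i with
  | zero =>
    simp only [Nat.not_lt_zero, if_false]
    split_ifs with h
    · obtain rfl : i = 0 := by ext; exact h
      exact lehmerCode_eq_zero_of_apply_eq_zero π h0
    · have := i.2
      rw [tailCode, dif_pos (by omega)]
      congr 1
      ext; simp; omega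
  | succ k ih =>
    have e := shiftFirst_succ π ⟨k, by omega⟩
    simp only at e
    rw [e, lehmerCode_mul_adjSwap _ _ (shiftFirst_lt π h0 ⟨k, by omega⟩), ih (by omega)]
    by_cases h1 : i = Fin.castSucc ⟨k, by omega⟩
    · subst h1
      simp [adjSwap]
    by_cases h2 : i = Fin.succ ⟨k, by omega⟩
    · subst h2
      simp [adjSwap, Fin.ext_iff]
    rw [adjSwap_of_ne h1 h2, if_neg h1]
    simp only [Fin.ext_iff, Fin.val_castSucc, Fin.val_succ] at h1 h2
    split_ifs <;> first | rfl | omega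

theorem avoids132_shiftFirst (π : Equiv.Perm (Fin (n + 1))) (π' : Equiv.Perm (Fin n))
    (hfirst : π 0 = 0) (hrest : ∀ i : Fin n, π i.succ = (π' i).succ) (h : Avoids132 π') :
    Avoids132 (shiftFirst π n) := by
  obtain ⟨h1, h2, _⟩ := shiftFirst_apply π n le_rfl
  have h1' : ∀ j : Fin n, shiftFirst π n j.castSucc = (π' j).succ := fun j => by
    rw [h1 j j.2, hrest]
  have h2' : shiftFirst π n (Fin.last n) = 0 := by rw [← hfirst]; exact h2
  intro a b c hab hbc hac hcb
  rcases Fin.eq_castSucc_or_eq_last c with ⟨c, rfl⟩ | rfl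
  · obtain ⟨b, rfl⟩ := Fin.exists_castSucc_eq.2 (hbc.trans_le (Fin.le_last _)).ne
    obtain ⟨a, rfl⟩ := Fin.exists_castSucc_eq.2 (hab.trans_le (Fin.le_last _)).ne
    simp only [h1', Fin.succ_lt_succ_iff, Fin.castSucc_lt_castSucc_iff] at *
    exact h a b c hab hbc hac hcb
  · rw [h2'] at hac
    exact Fin.not_lt_zero _ hac

theorem tailCode_of_le (π : Equiv.Perm (Fin (n + 1))) {i : ℕ} (h : n ≤ i + 1) :
    tailCode π i = 0 := by
  unfold tailCode
  split_ifs with h'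
  · have : (Fin.succ ⟨i, h'⟩ : Fin (n + 1)) = Fin.last n := by ext; simp; omega
    rw [this, lehmerCode]
    simp [Fin.le_last]
  · rfl

/-- Once the minimum is in last place the permutation avoids 132 and its code is the tail code plus
one; codes of 132-avoiding permutations decrease weakly. -/
theorem antitone_tailCode (π : Equiv.Perm (Fin (n + 1))) (π' : Equiv.Perm (Fin n))
    (hfirst : π 0 = 0) (hrest : ∀ i : Fin n, π i.succ = (π' i).succ) (h : Avoids132 π') :
    Antitone (tailCode π) := by
  refine antitone_nat_of_succ_le fun i => ?_
  by_cases hi : n ≤ i + 2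
  · rw [tailCode_of_le π (by omega)]; exact Nat.zero_le _
  have := (avoids132_shiftFirst π π' hfirst hrest h).lehmerCode_le
    (i := ⟨i, by omega⟩) (j := ⟨i + 1, by omega⟩) (by simp)
  rw [lehmerCode_shiftFirst π hfirst n le_rfl, lehmerCode_shiftFirst π hfirst n le_rfl] at this
  simp only at this
  rw [if_pos (by omega), if_pos (by omega)] at this
  omega

theorem inversionNumber_eq_sum_tailCode (π : Equiv.Perm (Fin (n + 1))) (h0 : π 0 = 0) :
    inversionNumber π = ∑ i ∈ Finset.range n, tailCode π i := by
  rw [inversionNumber, Fin.sum_univ_succ, lehmerCode_eq_zero_of_apply_eq_zero π h0, zero_add,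
    Finset.sum_range]
  refine Finset.sum_congr rfl fun i _ => ?_
  rw [tailCode, dif_pos i.2]

end MoveZero

/-! ### Commuting row factors in the 0-Hecke algebra. -/

section FominKirillov

variable {R E : Type*} [CommRing R] [Ring E] [Algebra R E]

/-- The factor `1 + x u_k` of Fomin and Kirillov. -/
def hFactor (U : ℕ → E) (k : ℕ) (x : R) : E := 1 + x • U k

/-- The product `h_i(x) h_{i+1}(x) ⋯ h_{i+d-1}(x)`. -/
def rowFactor (U : ℕ → E) : ℕ → ℕ → R → E
  | 0, _, _ => 1
  | d + 1, i, x => hFactor U i x * rowFactor U d (i + 1) x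

/-- The product of the factors of the rows `m - 1, …, 0`. -/
def rowsFactor (U : ℕ → E) (n : ℕ) (x : ℕ → R) : ℕ → E
  | 0 => 1
  | m + 1 => rowFactor U (n - m) m (x m) * rowsFactor U n x m

/-- The relations of the 0-Hecke monoid. -/
structure ZeroHeckeRelations (U : ℕ → E) : Prop where
  idem : ∀ k, U k * U k = U k
  braid : ∀ k, U k * U (k + 1) * U k = U (k + 1) * U k * U (k + 1)
  comm : ∀ k l, k + 2 ≤ l → U k * U l = U l * U k

variable {U : ℕ → E}

theorem hFactor_comm (hU : ZeroHeckeRelations U) {k l : ℕ} (h : k + 2 ≤ l) (x y : R) :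
    Commute (hFactor U k x) (hFactor U l y) := by
  have : Commute (U k) (U l) := hU.comm k l h
  unfold hFactor
  exact ((Commute.one_right _).add_right
    ((Commute.one_left _).add_left (this.smul_left x) |>.smul_right y))

theorem hFactor_rowFactor_comm (hU : ZeroHeckeRelations U) {k : ℕ} (x y : R) (d : ℕ) :
    ∀ l, k + 2 ≤ l → Commute (hFactor U k x) (rowFactor U d l y) := by
  induction d with
  | zero => intro l _; exact Commute.one_right _
  | succ d ih =>
    intro l hl
    exact (hFactor_comm hU hl x y).mul_right (ih (l + 1) (by omega))

theorem hFactor_self_comm (k : ℕ) (x y : R) :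
    Commute (hFactor U k x) (hFactor U k y) := by
  unfold hFactor
  exact ((Commute.one_right _).add_right
    ((Commute.one_left _).add_left ((Commute.refl (U k)).smul_left x) |>.smul_right y))

/-- This is the Yang–Baxter equation with third parameter `(x - y) / (1 + y)`, multiplied by `1 + y`
to avoid division. -/
theorem yangBaxter (hU : ZeroHeckeRelations U) (i : ℕ) (x y : R) :
    hFactor U (i + 1) y * hFactor U i x * ((1 + y) • (1 : E) + (x - y) • U (i + 1)) =
      ((1 + y) • (1 : E) + (x - y) • U i) * hFactor U (i + 1) x * hFactor U i y := by
  have h1 := hU.idem i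
  have h2 := hU.idem (i + 1)
  have h3 := hU.braid i
  unfold hFactor
  generalize U i = u at *
  generalize U (i + 1) = v at *
  simp only [mul_add, add_mul, mul_one, one_mul, smul_mul_assoc, mul_smul_comm, smul_add,
    smul_smul, h1, h2, h3]
  module

theorem hFactor_mul_adjust (hU : ZeroHeckeRelations U) (i : ℕ) (x y : R) :
    hFactor U i y * ((1 + y) • (1 : E) + (x - y) • U i) = (1 + y) • hFactor U i x := by
  have h1 := hU.idem i
  unfold hFactor
  simp only [mul_add, add_mul, mul_one, one_mul, smul_mul_assoc, mul_smul_comm, smul_add,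
    smul_smul, h1]
  module

/-- Because `U i` is idempotent, the left factor is `1 + y` times an inverse of `hFactor U i y`; the
case `x = y` says so. -/
theorem quasiInverse_mul_hFactor (hU : ZeroHeckeRelations U) (i : ℕ) (x y : R) :
    ((1 + y) • (1 : E) - y • U i) * hFactor U i x = (1 + y) • (1 : E) + (x - y) • U i := by
  have h1 := hU.idem i
  unfold hFactor
  simp only [mul_add, sub_mul, mul_one, one_mul, smul_mul_assoc, mul_smul_comm, smul_smul,
    smul_sub, h1]
  module

/-- The row factors with the same starting index commute. -/
theorem rowFactor_comm (hU : ZeroHeckeRelations U) (x y : R)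
    (hreg : ∀ a b : E, (1 + y) • a = (1 + y) • b → a = b) (d : ℕ) :
    ∀ i, rowFactor U d i y * rowFactor U d i x = rowFactor U d i x * rowFactor U d i y := by
  induction d with
  | zero => intro i; rfl
  | succ d ih =>
    intro i
    rcases d with _ | e
    · simpa [rowFactor] using (hFactor_self_comm i y x).eq
    · have ih' := ih (i + 1)
      simp only [rowFactor] at ih' ⊢
      set B : R → E := fun y => rowFactor U e (i + 1 + 1) y with hB
      have hc : ∀ x y, B y * hFactor U i x = hFactor U i x * B y := fun x y =>
        (hFactor_rowFactor_comm hU x y e (i + 1 + 1) (by omega)).eq.symm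
      change hFactor U (i + 1) y * B y * (hFactor U (i + 1) x * B x) =
        hFactor U (i + 1) x * B x * (hFactor U (i + 1) y * B y) at ih'
      change hFactor U i y * (hFactor U (i + 1) y * B y) *
        (hFactor U i x * (hFactor U (i + 1) x * B x)) =
        hFactor U i x * (hFactor U (i + 1) x * B x) *
          (hFactor U i y * (hFactor U (i + 1) y * B y))
      have e1 : ∀ x y, hFactor U i y * (hFactor U (i + 1) y * B y) *
          (hFactor U i x * (hFactor U (i + 1) x * B x)) =
          hFactor U i y * hFactor U (i + 1) y * hFactor U i x *
            (B y * hFactor U (i + 1) x * B x) := by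
        intro x y
        calc _ = hFactor U i y * hFactor U (i + 1) y * (B y * hFactor U i x) *
              (hFactor U (i + 1) x * B x) := by simp only [mul_assoc]
          _ = _ := by rw [hc]; simp only [mul_assoc]
      rw [e1, e1]
      apply hreg
      -- Insert the quasi-inverse of the leading factor, exchange the two shorter rows by induction,
      -- and absorb the quasi-inverse into the new leading factor. This produces the third
      -- Yang–Baxter factor.
      have e2 : (1 + y) • (B y * hFactor U (i + 1) x * B x) =
          ((1 + y) • (1 : E) + (x - y) • U (i + 1)) * (B x * hFactor U (i + 1) y * B y) := by
        have h0 := quasiInverse_mul_hFactor hU (i + 1) y y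
        rw [sub_self, zero_smul, add_zero] at h0
        calc _ = ((1 + y) • (1 : E)) * (B y * hFactor U (i + 1) x * B x) := by simp
          _ = ((1 + y) • (1 : E) - y • U (i + 1)) *
              (hFactor U (i + 1) y * B y * (hFactor U (i + 1) x * B x)) := by
            conv_lhs => rw [← h0]
            simp only [mul_assoc]
          _ = _ := by
            rw [ih', ← quasiInverse_mul_hFactor hU (i + 1) x y]; simp only [mul_assoc]
      calc _ = hFactor U i y * (hFactor U (i + 1) y * hFactor U i x) *
            ((1 + y) • (B y * hFactor U (i + 1) x * B x)) := by
            simp only [mul_smul_comm, mul_assoc]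
        _ = hFactor U i y * (hFactor U (i + 1) y * hFactor U i x *
            ((1 + y) • (1 : E) + (x - y) • U (i + 1))) * (B x * hFactor U (i + 1) y * B y) := by
            rw [e2]; simp only [mul_assoc]
        _ = hFactor U i y * ((1 + y) • (1 : E) + (x - y) • U i) * (hFactor U (i + 1) x *
            hFactor U i y) * (B x * hFactor U (i + 1) y * B y) := by
            rw [yangBaxter hU]; simp only [mul_assoc]
        _ = _ := by
            rw [hFactor_mul_adjust hU]; simp only [mul_assoc, smul_mul_assoc]

theorem rowsFactor_congr {n : ℕ} {x y : ℕ → R} (m : ℕ) (h : ∀ i < m, x i = y i) :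
    rowsFactor U n x m = rowsFactor U n y m := by
  induction m with
  | zero => rfl
  | succ m ih =>
    simp only [rowsFactor]
    rw [h m (by omega), ih fun i hi => h i (by omega)]

/-- The Fomin–Kirillov symmetry of the product of all row factors. -/
theorem hFactor_mul_rowsFactor (hU : ZeroHeckeRelations U) {n : ℕ} (x : ℕ → R)
    (hreg : ∀ i, ∀ a b : E, (1 + x i) • a = (1 + x i) • b → a = b) {i : ℕ} (hi : i < n) (m : ℕ)
    (hm : i + 2 ≤ m) :
    hFactor U i (x (i + 1)) * rowsFactor U n x m =
      hFactor U i (x i) * rowsFactor U n (x ∘ Equiv.swap i (i + 1)) m := by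
  induction m, hm using Nat.le_induction with
  | base =>
    simp only [rowsFactor, Function.comp_apply, Equiv.swap_apply_left, Equiv.swap_apply_right]
    have e : rowsFactor U n (x ∘ Equiv.swap i (i + 1)) i = rowsFactor U n x i :=
      rowsFactor_congr i fun j hj => by
        simp [Equiv.swap_apply_of_ne_of_ne hj.ne (by omega : j ≠ i + 1)]
    have e2 : n - i = (n - (i + 1)) + 1 := by omega
    -- The extra factor on the left completes row `i + 1` to a row starting at `i`, which commutes
    -- with row `i`. Later rows involve only generators that commute with `U i`.
    have e3 : ∀ y : R, hFactor U i y * rowFactor U (n - (i + 1)) (i + 1) y =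
        rowFactor U (n - i) i y := fun y => by rw [e2]; rfl
    rw [e, ← mul_assoc, ← mul_assoc, ← mul_assoc, ← mul_assoc, e3, e3,
      rowFactor_comm hU _ _ (hreg (i + 1))]
  | succ m hm ih =>
    have e : (x ∘ Equiv.swap i (i + 1)) m = x m := by
      simp [Equiv.swap_apply_of_ne_of_ne (by omega : m ≠ i) (by omega : m ≠ i + 1)]
    simp only [rowsFactor, e]
    rw [← mul_assoc, (hFactor_rowFactor_comm hU _ _ _ m hm).eq, mul_assoc, ih, ← mul_assoc,
      ← (hFactor_rowFactor_comm hU _ _ _ m hm).eq, mul_assoc]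

end FominKirillov

/-! ### The 0-Hecke action on permutations and divided differences. -/

section Demazure

variable {n : ℕ}

/-- Both sides sort the three entries into decreasing order. -/
theorem sortPair_braid {α β : Type*} [DecidableEq α] [LinearOrder β]
    (σ : α ≃ β) {a b c : α} (hab : a ≠ b) (hbc : b ≠ c) (hac : a ≠ c)
    (f g : (α ≃ β) → (α ≃ β))
    (hf : ∀ σ, f σ = if σ a < σ b then (Equiv.swap a b).trans σ else σ)
    (hg : ∀ σ, g σ = if σ b < σ c then (Equiv.swap b c).trans σ else σ) :
    f (g (f σ)) = g (f (g σ)) := by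
  have h1 : σ a ≠ σ b := fun h => hab (σ.injective h)
  have h2 : σ b ≠ σ c := fun h => hbc (σ.injective h)
  have h3 : σ a ≠ σ c := fun h => hac (σ.injective h)
  have s1 : Equiv.swap a b c = c := Equiv.swap_apply_of_ne_of_ne hac.symm hbc.symm
  have s2 : Equiv.swap b c a = a := Equiv.swap_apply_of_ne_of_ne hab hac
  have s3 : (Equiv.swap a b).trans ((Equiv.swap b c).trans (Equiv.swap a b)) =
      (Equiv.swap b c).trans ((Equiv.swap a b).trans (Equiv.swap b c)) := by
    have e1 := Equiv.swap_mul_swap_mul_swap (x := a) (y := b) (z := c) hab hac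
    have e2 := Equiv.swap_mul_swap_mul_swap (x := c) (y := b) (z := a) hbc.symm hac.symm
    simp only [Equiv.Perm.mul_def] at e1 e2
    rw [Equiv.swap_comm c b, Equiv.swap_comm b a, Equiv.swap_comm a c] at e2
    first | exact e1.trans e2.symm | exact e2.trans e1.symm
  have s3' : (Equiv.swap a b).trans ((Equiv.swap b c).trans ((Equiv.swap a b).trans σ)) =
      (Equiv.swap b c).trans ((Equiv.swap a b).trans ((Equiv.swap b c).trans σ)) := by
    have := congrArg (fun e => Equiv.trans e σ) s3
    simpa only [Equiv.trans_assoc] using this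
  by_cases c1 : σ a < σ b <;> by_cases c2 : σ b < σ c <;> by_cases c3 : σ a < σ c <;>
    simp [hf, hg, c1, c2, c3, s1, s2, s3']
  · exact absurd (c1.trans c2) c3
  · exact fun h => absurd h c1.asymm
  · exact fun h => absurd h c2.asymm

theorem demazureStep_idem (k : Fin n) (σ : Equiv.Perm (Fin (n + 1))) :
    demazureStep k (demazureStep k σ) = demazureStep k σ := by
  by_cases h : σ k.castSucc < σ k.succ
  · have : ¬ (σ * adjSwap k) k.castSucc < (σ * adjSwap k) k.succ := by
      simpa [adjSwap] using h.le
    simp only [demazureStep, if_pos h, if_neg this]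
  · simp only [demazureStep, if_neg h]

theorem demazureStep_braid (k l : Fin n) (hkl : (k : ℕ) + 1 = l) (σ : Equiv.Perm (Fin (n + 1))) :
    demazureStep k (demazureStep l (demazureStep k σ)) =
      demazureStep l (demazureStep k (demazureStep l σ)) := by
  have e : k.succ = l.castSucc := by ext; simpa using hkl
  refine sortPair_braid σ (a := k.castSucc) (b := k.succ) (c := l.succ) ?_ ?_ ?_ _ _
    (fun _ => rfl) (fun _ => by rw [e]; rfl) <;> simp [Fin.ext_iff] <;> omega

theorem demazureStep_comm (k l : Fin n) (hkl : (k : ℕ) + 2 ≤ l) (σ : Equiv.Perm (Fin (n + 1))) :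
    demazureStep k (demazureStep l σ) = demazureStep l (demazureStep k σ) := by
  have a1 : adjSwap l k.castSucc = k.castSucc :=
    adjSwap_of_ne (by simp [Fin.ext_iff]; omega) (by simp [Fin.ext_iff]; omega)
  have a2 : adjSwap l k.succ = k.succ :=
    adjSwap_of_ne (by simp [Fin.ext_iff]; omega) (by simp [Fin.ext_iff]; omega)
  have a3 : adjSwap k l.castSucc = l.castSucc :=
    adjSwap_of_ne (by simp [Fin.ext_iff]; omega) (by simp [Fin.ext_iff]; omega)
  have a4 : adjSwap k l.succ = l.succ :=
    adjSwap_of_ne (by simp [Fin.ext_iff]; omega) (by simp [Fin.ext_iff]; omega)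
  have hc : adjSwap k * adjSwap l = adjSwap l * adjSwap k :=
    Equiv.ext fun i => by
      simp only [Equiv.Perm.mul_apply, Fin.ext_iff, val_adjSwap]
      split_ifs <;> omega
  by_cases h1 : σ k.castSucc < σ k.succ <;> by_cases h2 : σ l.castSucc < σ l.succ <;>
    simp [demazureStep, h1, h2, a1, a2, a3, a4, mul_assoc, hc]

variable (R : Type*) [CommRing R]

/-- The generators of the 0-Hecke algebra acting on the free module on the permutations. -/
noncomputable def demazureOp (n k : ℕ) : Module.End R (Equiv.Perm (Fin (n + 1)) →₀ R) :=
  -- The value zero outside the range keeps the relations valid for all natural indices.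
  if h : k < n then Finsupp.lmapDomain R R (demazureStep ⟨k, h⟩) else 0

theorem demazureOp_single {k : ℕ} (h : k < n) (σ : Equiv.Perm (Fin (n + 1))) (a : R) :
    demazureOp R n k (Finsupp.single σ a) = Finsupp.single (demazureStep ⟨k, h⟩ σ) a := by
  rw [demazureOp, dif_pos h, Finsupp.lmapDomain_apply, Finsupp.mapDomain_single]

theorem zeroHeckeRelations_demazureOp : ZeroHeckeRelations (demazureOp R n) where
  idem k := by
    by_cases h : k < n
    · ext σ : 2
      simp [demazureOp_single R h, demazureStep_idem]
    · simp [demazureOp, h]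
  braid k := by
    by_cases h : k + 1 < n
    · ext σ : 2
      simp [demazureOp_single R h, demazureOp_single R (Nat.lt_of_succ_lt h),
        demazureStep_braid ⟨k, Nat.lt_of_succ_lt h⟩ ⟨k + 1, h⟩ rfl]
    · simp [demazureOp, h]
  comm k l hkl := by
    by_cases h : l < n
    · ext σ : 2
      simp [demazureOp_single R h, demazureOp_single R (by omega : k < n),
        demazureStep_comm ⟨k, by omega⟩ ⟨l, h⟩ hkl]
    · simp [demazureOp, h]

theorem demazureOp_apply_of_lt (k : Fin n) (F : Equiv.Perm (Fin (n + 1)) →₀ R)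
    (v : Equiv.Perm (Fin (n + 1))) (h : v k.castSucc < v k.succ) :
    demazureOp R n k F v = 0 := by
  induction F using Finsupp.induction_linear with
  | zero => simp
  | add f g hf hg => simp [hf, hg]
  | single σ a =>
    rw [demazureOp_single R k.2, Finsupp.single_apply, if_neg]
    rintro rfl
    simp only [demazureStep, Fin.eta] at h
    split_ifs at h with h'
    · simp only [Equiv.Perm.mul_apply, adjSwap, Equiv.swap_apply_left,
        Equiv.swap_apply_right] at h
      exact h.asymm h'
    · exact h' h

/-- A permutation with a descent at `k` has two preimages under the Demazure step: itself and the
permutation with the descent undone. -/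
theorem demazureOp_apply_mul_adjSwap (k : Fin n) (F : Equiv.Perm (Fin (n + 1)) →₀ R)
    (v : Equiv.Perm (Fin (n + 1))) (h : v k.castSucc < v k.succ) :
    demazureOp R n k F (v * adjSwap k) = F (v * adjSwap k) + F v := by
  induction F using Finsupp.induction_linear with
  | zero => simp
  | add f g hf hg => simp only [map_add, Finsupp.add_apply, hf, hg]; ring
  | single σ a =>
    have hw : ¬ (v * adjSwap k) k.castSucc < (v * adjSwap k) k.succ := by
      simpa [adjSwap] using h.le
    have hne : v * adjSwap k ≠ v := fun e => by rw [e] at hw; exact hw h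
    rw [demazureOp_single R k.2]
    simp only [demazureStep, Fin.eta, Finsupp.single_apply]
    by_cases h1 : σ = v
    · subst h1
      rw [if_pos h, if_pos rfl, if_pos rfl, if_neg hne.symm, zero_add]
    by_cases h2 : σ = v * adjSwap k
    · subst h2
      rw [if_neg hw]
      simp [hne]
    · rw [if_neg h1, if_neg h2]
      split_ifs with h3 h4
      · exact absurd (mul_right_cancel h4) h1
      · simp
      · simp_all

/-- The generating function of all tilings by their permutation. -/
noncomputable def tilingSum (n : ℕ) (x : ℕ → R) : Equiv.Perm (Fin (n + 1)) →₀ R :=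
  -- Row `n` has no factors; counting it makes the symmetry in `x k` and `x (k + 1)` available for
  -- `k = n - 1` as well.
  rowsFactor (demazureOp R n) n x (n + 1) (Finsupp.single 1 1)

variable {R}

theorem demazureOp_hFactor (k : ℕ) (y : R) (F : Equiv.Perm (Fin (n + 1)) →₀ R) :
    hFactor (demazureOp R n) k y F = F + y • demazureOp R n k F := by
  simp [hFactor]

/-- The divided difference recursion of the coefficients. -/
theorem tilingSum_divided [IsDomain R] (x : ℕ → R) (hx : ∀ i, 1 + x i ≠ 0) (k : Fin n)
    (v : Equiv.Perm (Fin (n + 1))) (h : v k.castSucc < v k.succ) :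
    (x k - x (k + 1)) * tilingSum R n x v =
      (1 + x (k + 1)) * tilingSum R n x (v * adjSwap k) -
        (1 + x k) * tilingSum R n (x ∘ Equiv.swap (k : ℕ) (k + 1)) (v * adjSwap k) := by
  have hsym := hFactor_mul_rowsFactor (zeroHeckeRelations_demazureOp R (n := n)) x
    (fun i a b hab => by
      ext σ τ
      have := congrArg (fun f => f (Finsupp.single σ 1) τ) hab
      simp only [LinearMap.smul_apply, Finsupp.smul_apply, smul_eq_mul] at this
      simpa using mul_left_cancel₀ (hx i) this) k.2 (n + 1) (by omega)
  have hs := congrArg (fun f => f (Finsupp.single 1 1)) hsym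
  simp only [Module.End.mul_apply, demazureOp_hFactor] at hs
  change tilingSum R n x + x (k + 1) • demazureOp R n k (tilingSum R n x) =
    tilingSum R n (x ∘ Equiv.swap (k : ℕ) (k + 1)) +
      x k • demazureOp R n k (tilingSum R n (x ∘ Equiv.swap (k : ℕ) (k + 1))) at hs
  -- At `v` the operator contributes nothing, so this coefficient is symmetric in the two variables;
  -- comparing at `v * adjSwap k` then gives the recursion.
  have h1 := DFunLike.congr_fun hs v
  have h2 := DFunLike.congr_fun hs (v * adjSwap k)
  simp only [Finsupp.add_apply, Finsupp.smul_apply, smul_eq_mul,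
    demazureOp_apply_of_lt R k _ v h, demazureOp_apply_mul_adjSwap R k _ v h] at h1 h2
  linear_combination x k * h1 - h2

end Demazure

/-! ### The 0-Hecke product as a sum over tilings. -/

section TilingSum

variable {n : ℕ} {R : Type*} [CommRing R]

/-- The product of the factors of a list of tiles; the first tile acts first. -/
noncomputable def tilesFactor (x : ℕ → R) :
    List (Tile n) → Module.End R (Equiv.Perm (Fin (n + 1)) →₀ R)
  | [] => 1
  | c :: l => tilesFactor x l * hFactor (demazureOp R n) (Tile.diagonal c) (x c.1.1)

theorem tilesFactor_append (x : ℕ → R) (l l' : List (Tile n)) :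
    tilesFactor x (l ++ l') = tilesFactor x l' * tilesFactor x l := by
  induction l with
  | nil => simp [tilesFactor]
  | cons c l ih => simp [tilesFactor, ih, mul_assoc]

theorem tilesFactor_reverse (x : ℕ → R) (l : List (Tile n)) :
    tilesFactor x l.reverse =
      (l.map fun c => hFactor (demazureOp R n) (Tile.diagonal c) (x c.1.1)).prod := by
  induction l with
  | nil => simp [tilesFactor]
  | cons c l ih => simp [tilesFactor, tilesFactor_append, ih]

/-- Expanding the product, the tiles where `x u` is chosen instead of `1` are the crosses. -/
theorem tilesFactor_single (x : ℕ → R) (l : List (Tile n)) (hl : l.Nodup) :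
    ∀ σ : Equiv.Perm (Fin (n + 1)), tilesFactor x l (Finsupp.single σ 1) =
      ∑ D ∈ l.toFinset.powerset, (∏ c ∈ D, x c.1.1) •
        Finsupp.single ((l.filter fun c => c ∈ D).foldl passCross σ) (1 : R) := by
  induction l with
  | nil => intro σ; simp [tilesFactor]
  | cons c l ih =>
    intro σ
    obtain ⟨hc, hl⟩ := List.nodup_cons.1 hl
    have hc' : c ∉ l.toFinset := by simpa using hc
    rw [List.toFinset_cons, Finset.sum_powerset_insert hc', tilesFactor, Module.End.mul_apply,
      demazureOp_hFactor, demazureOp_single R (Tile.diagonal c).2, map_add, map_smul]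
    have hp : demazureStep ⟨(Tile.diagonal c : ℕ), (Tile.diagonal c).2⟩ σ = passCross σ c := rfl
    rw [hp, ih hl, ih hl, Finset.smul_sum]
    have hcD : ∀ D ∈ l.toFinset.powerset, c ∉ D := fun D hD h =>
      hc' (Finset.mem_powerset.1 hD h)
    congr 1
    · refine Finset.sum_congr rfl fun D hD => ?_
      rw [List.filter_cons_of_neg (by simpa using hcD D hD)]
    · refine Finset.sum_congr rfl fun D hD => ?_
      rw [Finset.prod_insert (hcD D hD), List.filter_cons_of_pos (by simp), List.foldl_cons,
        smul_smul]
      congr 3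
      refine List.filter_congr fun d hd => ?_
      have : d ≠ c := by rintro rfl; exact hc hd
      simp [this]

theorem filterMap_range_lt {α : Type*} (f : ℕ → α) (d m : ℕ) :
    (List.range m).filterMap (fun j => if j < d then some (f j) else none) =
      (List.range (min m d)).map f := by
  induction m with
  | zero => simp
  | succ m ih =>
    rw [List.range_succ, List.filterMap_append, ih]
    by_cases h : m < d
    · have e1 : min m d = m := by omega
      simp [h, e1, List.range_succ]
    · have e1 : min m d = d := by omega
      have e2 : min (m + 1) d = d := by omega
      simp [h, e1, e2]

theorem rowFactor_eq_prod {E : Type*} [Ring E] [Algebra R E] (U : ℕ → E) (x : R) (d : ℕ) :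
    ∀ i, rowFactor U d i x = ((List.range d).map fun j => hFactor U (i + j) x).prod := by
  induction d with
  | zero => intro i; rfl
  | succ d ih =>
    intro i
    rw [rowFactor, ih, List.range_succ_eq_map, List.map_cons, List.prod_cons, List.map_map]
    congr 3
    ext j
    simp only [Function.comp_apply]
    congr 1
    omega

/-- The tiles of a row, from right to left. -/
def tileRow (n i : ℕ) : List (Tile n) :=
  if hi : i < n then
    (List.finRange n).reverse.filterMap fun (j : Fin n) =>
      if h : ((⟨i, hi⟩ : Fin n) : ℕ) + (j : ℕ) < n then some ⟨(⟨i, hi⟩, j), h⟩ else none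
  else []

theorem tileList_eq_flatMap (n : ℕ) : tileList n = (List.range n).flatMap (tileRow n) := by
  rw [← List.map_coe_finRange_eq_range, List.flatMap_map, tileList]
  congr 1
  ext i
  simp [tileRow]

theorem tilesFactor_tileRow (x : ℕ → R) (i : ℕ) :
    tilesFactor x (tileRow n i) = rowFactor (demazureOp R n) (n - i) i (x i) := by
  by_cases hi : i < n
  -- The rightmost tile of a row acts first and so stands last in the operator product; reading
  -- tiles from right to left matches generator indices increasing from left to right.
  · rw [tileRow, dif_pos hi, List.filterMap_reverse, tilesFactor_reverse, rowFactor_eq_prod]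
    congr 1
    have := filterMap_range_lt (fun j => hFactor (demazureOp R n) (i + j) (x i)) (n - i) n
    rw [min_eq_right (Nat.sub_le _ _), ← List.map_coe_finRange_eq_range, List.filterMap_map] at this
    rw [← this, List.map_filterMap]
    congr 1
    ext j : 1
    by_cases h : i + (j : ℕ) < n
    · have h' : (j : ℕ) < n - i := by omega
      simp [h, h', Tile.diagonal]
    · have h' : ¬ (j : ℕ) < n - i := by omega
      simp [h, h']
  · rw [tileRow, dif_neg hi, Nat.sub_eq_zero_of_le (not_lt.1 hi)]
    rfl

theorem tilesFactor_tileList (x : ℕ → R) :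
    tilesFactor x (tileList n) = rowsFactor (demazureOp R n) n x (n + 1) := by
  have h : ∀ m, tilesFactor x ((List.range m).flatMap (tileRow n)) =
      rowsFactor (demazureOp R n) n x m := by
    intro m
    induction m with
    | zero => rfl
    | succ m ih =>
      rw [List.range_succ, List.flatMap_append, tilesFactor_append, ih]
      simp [tilesFactor_tileRow, rowsFactor]
  rw [tileList_eq_flatMap, h]
  simp [rowsFactor, rowFactor]

theorem tilingSum_eq_sum (x : ℕ → R) :
    tilingSum R n x = ∑ D : Finset (Tile n),
      (∏ c ∈ D, x c.1.1) • Finsupp.single (strandPerm D) (1 : R) := by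
  have h : (tileList n).toFinset = Finset.univ := by
    ext c; simp [mem_tileList]
  rw [tilingSum, ← tilesFactor_tileList, tilesFactor_single x _ (nodup_tileList n), h,
    Finset.powerset_univ]
  rfl

theorem tilingSum_apply (x : ℕ → R) (w : Equiv.Perm (Fin (n + 1))) :
    tilingSum R n x w = ∑ D ∈ pipeDreams w, ∏ c ∈ D, x c.1.1 := by
  rw [tilingSum_eq_sum, Finsupp.finsetSum_apply, pipeDreams, Finset.sum_filter]
  simp [Finsupp.single_apply]

end TilingSum

/-! ### Explicit coefficients by repeated divided differences. -/

section Explicit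

variable {n : ℕ} {R : Type*} [CommRing R]

/-- The values `x 0, …, x n` are distinct, and no value is `-1`. -/
structure GenericValues (n : ℕ) (x : ℕ → R) : Prop where
  inj : ∀ i ≤ n, ∀ j ≤ n, x i = x j → i = j
  ne : ∀ i, 1 + x i ≠ 0

theorem GenericValues.comp_swap {x : ℕ → R} (hx : GenericValues n x) {k : ℕ} (hk : k < n) :
    GenericValues n (x ∘ Equiv.swap k (k + 1)) where
  inj i hi j hj h := by
    have hle : ∀ i ≤ n, Equiv.swap k (k + 1) i ≤ n := fun i hi => by
      rw [Equiv.swap_apply_def]; split_ifs <;> omega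
    exact (Equiv.swap k (k + 1)).injective (hx.inj _ (hle i hi) _ (hle j hj) h)
  ne i := hx.ne _

theorem GenericValues.sub_ne_zero {x : ℕ → R} (hx : GenericValues n x) (k : Fin n) :
    x k - x (k + 1) ≠ 0 := by
  intro h
  have := hx.inj k (by omega) (k + 1) (by omega) (sub_eq_zero.1 h)
  omega

theorem inversionNumber_le {m : ℕ} (σ : Equiv.Perm (Fin m)) : inversionNumber σ ≤ m * m := by
  have : ∀ i ∈ (Finset.univ : Finset (Fin m)), lehmerCode σ i ≤ m := fun i _ =>
    (Finset.card_le_univ _).trans (by simp)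
  simpa [inversionNumber] using Finset.sum_le_card_nsmul _ _ _ this

/-- Induction on permutations from the longest one downwards along first ascents. -/
theorem descending_induction {P : Equiv.Perm (Fin (n + 1)) → Prop}
    (h0 : ∀ w, (∀ k : Fin n, w k.succ < w k.castSucc) → P w)
    (h1 : ∀ w, ∀ k : Fin n, w k.castSucc < w k.succ →
      (∀ j < k, w j.succ < w j.castSucc) → P (w * adjSwap k) → P w)
    (w : Equiv.Perm (Fin (n + 1))) : P w := by
  have key : ∀ N : ℕ, ∀ w : Equiv.Perm (Fin (n + 1)),
      (n + 1) * (n + 1) - inversionNumber w ≤ N → P w := by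
    intro N
    induction N with
    | zero =>
      intro w hw
      refine h0 w fun k => ?_
      by_contra hk
      have hne : w k.succ ≠ w k.castSucc := fun e =>
        Fin.castSucc_lt_succ.ne (w.injective e).symm
      have h1 := inversionNumber_mul_adjSwap w k (lt_of_le_of_ne (not_lt.1 hk) hne.symm)
      have h2 := inversionNumber_le (w * adjSwap k)
      omega
    | succ N ih =>
      intro w hw
      by_cases hd : ∀ k : Fin n, w k.succ < w k.castSucc
      · exact h0 w hd
      have hne : (Finset.univ.filter fun k : Fin n => ¬ w k.succ < w k.castSucc).Nonempty := by
        push Not at hd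
        obtain ⟨k, hk⟩ := hd
        exact ⟨k, by simpa using hk⟩
      set k := Finset.min' _ hne with hkdef
      have hk := Finset.min'_mem _ hne
      rw [← hkdef] at hk
      simp only [Finset.mem_filter, Finset.mem_univ, true_and, not_lt] at hk
      have hlt : w k.castSucc < w k.succ :=
        lt_of_le_of_ne hk fun e => Fin.castSucc_lt_succ.ne (w.injective e)
      refine h1 w k hlt (fun j hj => ?_) (ih _ ?_)
      · by_contra hcon
        exact absurd (Finset.min'_le _ j (by simpa using hcon)) (not_le.2 (hkdef ▸ hj))
      · rw [inversionNumber_mul_adjSwap w k hlt]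
        omega
  exact key _ w le_rfl

theorem prod_tile (x : ℕ → R) :
    ∏ c : Tile n, x c.1.1 = ∏ i : Fin n, x i ^ (n - (i : ℕ)) := by
  rw [Fintype.prod_equiv (tileEquivSigma n) (fun c => x c.1.1) (fun s => x s.1) (fun c => rfl),
    Fintype.prod_sigma]
  simp

/-- Only the full tiling can read the longest permutation. If it did not, the coefficient there
would vanish, hence by the recursion all coefficients would; but they sum to a product of nonzero
terms `1 + x i`. -/
theorem strandPerm_univ_descending [IsDomain R] {x : ℕ → R} (hx : GenericValues n x) (k : Fin n) :
    strandPerm (Finset.univ : Finset (Tile n)) k.succ <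
      strandPerm (Finset.univ : Finset (Tile n)) k.castSucc := by
  by_contra hk
  have hz : ∀ w : Equiv.Perm (Fin (n + 1)), ∀ x : ℕ → R, GenericValues n x →
      tilingSum R n x w = 0 := by
    refine descending_induction (fun w hw x _ => ?_) (fun w k hlt _ ih x hx => ?_)
    · rw [tilingSum_apply]
      refine Finset.sum_eq_zero fun D hD => ?_
      simp only [pipeDreams, Finset.mem_filter, Finset.mem_univ, true_and] at hD
      subst hD
      rw [eq_univ_of_strandPerm_descending hw] at hw
      exact absurd (hw k) hk
    · have := tilingSum_divided x hx.ne k w hlt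
      rw [ih x hx, ih _ (hx.comp_swap k.2), mul_zero, mul_zero, sub_zero] at this
      exact (mul_eq_zero.1 this).resolve_left (hx.sub_ne_zero k)
  have h0 : tilingSum R n x = 0 := Finsupp.ext fun w => hz w x hx
  have h1 := congrArg (Finsupp.linearCombination R (fun _ : Equiv.Perm (Fin (n + 1)) => (1 : R))) h0
  rw [tilingSum_eq_sum, map_sum, map_zero] at h1
  simp only [map_smul, Finsupp.linearCombination_single, smul_eq_mul, mul_one] at h1
  have h2 := Finset.prod_one_add (f := fun c : Tile n => x c.1.1) Finset.univ
  rw [Finset.powerset_univ, h1] at h2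
  exact Finset.prod_ne_zero_iff.2 (fun c _ => hx.ne _) h2

theorem val_adjSwap_eq_swap (k : Fin n) (i : Fin (n + 1)) :
    (adjSwap k i : ℕ) = Equiv.swap (k : ℕ) (k + 1) i := by
  rw [val_adjSwap, Equiv.swap_apply_def]

/-- The coefficient of a 132-avoiding permutation is a single monomial. -/
theorem tilingSum_of_avoids132 [IsDomain R] (w : Equiv.Perm (Fin (n + 1))) :
    Avoids132 w → ∀ x : ℕ → R, GenericValues n x →
      tilingSum R n x w = ∏ i : Fin (n + 1), x i ^ lehmerCode w i := by
  induction w using descending_induction with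
  | h0 w hw =>
    intro _ x hx
    have hD : pipeDreams w = {Finset.univ} := by
      refine Finset.eq_singleton_iff_unique_mem.2 ⟨?_, fun D hD => ?_⟩
      · have h1 := Fin.strictAnti_iff_succ_lt.2 hw
        have h2 := Fin.strictAnti_iff_succ_lt.2 (strandPerm_univ_descending hx)
        simp only [pipeDreams, Finset.mem_filter, Finset.mem_univ, true_and]
        have e := ((Fin.rev_strictAnti.comp h2).range_inj (Fin.rev_strictAnti.comp h1)).1
          (by rw [Set.range_comp, Set.range_comp, Equiv.range_eq_univ, Equiv.range_eq_univ])
        exact Equiv.ext fun i => Fin.rev_injective (congrFun e i)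
      · simp only [pipeDreams, Finset.mem_filter, Finset.mem_univ, true_and] at hD
        subst hD
        exact eq_univ_of_strandPerm_descending hw
    rw [tilingSum_apply, hD, Finset.sum_singleton, prod_tile, Fin.prod_univ_castSucc]
    simp [lehmerCode_of_descending hw]
  | h1 w k hlt hfirst ih =>
    intro hw x hx
    have ih' := ih (hw.mul_adjSwap hlt hfirst)
    -- The code takes equal values at an ascent, so the monomial of `w` is symmetric in `x k` and `x
    -- (k + 1)`, and the monomial of `w * adjSwap k` is `x k` times it.
    have hcode : ∀ i, lehmerCode w (adjSwap k i) = lehmerCode w i := by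
      intro i
      have := hw.lehmerCode_eq hlt
      by_cases h1 : i = k.castSucc
      · subst h1; rw [adjSwap, Equiv.swap_apply_left, this]
      by_cases h2 : i = k.succ
      · subst h2; rw [adjSwap, Equiv.swap_apply_right, this]
      rw [adjSwap_of_ne h1 h2]
    have hprod : ∀ y : ℕ → R, ∏ i : Fin (n + 1), y i ^ lehmerCode (w * adjSwap k) i =
        (∏ i : Fin (n + 1), y i ^ lehmerCode w i) * y k := by
      intro y
      simp only [lehmerCode_mul_adjSwap w k hlt, hcode, pow_add, Finset.prod_mul_distrib]
      congr 1
      rw [Finset.prod_eq_single k.castSucc]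
      · simp
      · intro b _ hb; simp [hb]
      · simp
    have hsym : ∏ i : Fin (n + 1), (x ∘ Equiv.swap (k : ℕ) (k + 1)) i ^ lehmerCode w i =
        ∏ i : Fin (n + 1), x i ^ lehmerCode w i := by
      rw [← Equiv.prod_comp (adjSwap k)]
      refine Finset.prod_congr rfl fun i _ => ?_
      rw [hcode, Function.comp_apply, val_adjSwap_eq_swap, Equiv.swap_apply_self]
    have h := tilingSum_divided x hx.ne k w hlt
    rw [ih' x hx, ih' _ (hx.comp_swap k.2), hprod, hprod, hsym] at h
    simp only [Function.comp_apply, Equiv.swap_apply_left] at h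
    refine mul_left_cancel₀ (hx.sub_ne_zero k) ?_
    rw [h]; ring

/-- The exponents left in the variables `x_{k+1}, …, x_n`, `k = n - d`, after `d` divided
differences, for the terms in which `x_k` has exponent `p`. -/
noncomputable def carries (lam : ℕ → ℕ) (n : ℕ) : ℕ → ℕ → Multiset (ℕ →₀ ℕ)
  | 0, p => if p = 0 then {0} else 0
  | d + 1, p =>
    if p ≤ lam (n - (d + 1)) then
      -- The two sums are the two geometric sums of `divided_carry`; the second raises the degree by
      -- one more.
      (∑ b ∈ Finset.range (p + 1), (carries lam n d b).map
        fun α => α + Finsupp.single (n - d) (lam (n - (d + 1)) + b - p)) +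
      ∑ b ∈ Finset.range p, (carries lam n d b).map
        fun α => α + Finsupp.single (n - d) (lam (n - (d + 1)) + b + 1 - p)
    else 0

/-- The sum of the monomials with exponents in a multiset. -/
noncomputable def evalMultiset (x : ℕ → R) (M : Multiset (ℕ →₀ ℕ)) : R :=
  (M.map fun α => α.prod fun i e => x i ^ e).sum

theorem evalMultiset_map_add_single (x : ℕ → R) (M : Multiset (ℕ →₀ ℕ)) (k e : ℕ) :
    evalMultiset x (M.map fun α => α + Finsupp.single k e) = evalMultiset x M * x k ^ e := by
  rw [evalMultiset, Multiset.map_map, evalMultiset, ← Multiset.sum_map_mul_right]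
  congr 2
  ext α
  rw [Function.comp_apply, Finsupp.prod_add_index' (by simp) (by intros; rw [pow_add]),
    Finsupp.prod_single_index (by simp)]

theorem evalMultiset_add (x : ℕ → R) (M N : Multiset (ℕ →₀ ℕ)) :
    evalMultiset x (M + N) = evalMultiset x M + evalMultiset x N := by
  simp [evalMultiset]

theorem evalMultiset_sum (x : ℕ → R) (s : Finset ℕ) (M : ℕ → Multiset (ℕ →₀ ℕ)) :
    evalMultiset x (∑ b ∈ s, M b) = ∑ b ∈ s, evalMultiset x (M b) := by
  induction s using Finset.induction_on with
  | empty => simp [evalMultiset]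
  | insert a s ha ih => rw [Finset.sum_insert ha, Finset.sum_insert ha, evalMultiset_add, ih]

theorem evalMultiset_carries_succ (x : ℕ → R) (lam : ℕ → ℕ) (d p : ℕ)
    (hp : p ≤ lam (n - (d + 1))) :
    evalMultiset x (carries lam n (d + 1) p) =
      (∑ b ∈ Finset.range (p + 1), evalMultiset x (carries lam n d b) *
        x (n - d) ^ (lam (n - (d + 1)) + b - p)) +
      ∑ b ∈ Finset.range p, evalMultiset x (carries lam n d b) *
        x (n - d) ^ (lam (n - (d + 1)) + b + 1 - p) := by
  rw [carries, if_pos hp, evalMultiset_add, evalMultiset_sum, evalMultiset_sum]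
  simp only [evalMultiset_map_add_single]

theorem evalMultiset_carries_congr {x y : ℕ → R} (lam : ℕ → ℕ) (d : ℕ)
    (h : ∀ i, n - d < i → i ≤ n → x i = y i) (hd : d ≤ n) : ∀ p,
    evalMultiset x (carries lam n d p) = evalMultiset y (carries lam n d p) := by
  induction d with
  | zero => intro p; by_cases hp : p = 0 <;> simp [carries, hp, evalMultiset]
  | succ d ih =>
    intro p
    have ih' := ih (fun i h1 h2 => h i (by omega) h2) (by omega)
    by_cases hp : p ≤ lam (n - (d + 1))
    · simp only [evalMultiset_carries_succ _ lam d p hp, ih', h (n - d) (by omega) (by omega)]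
    · simp [carries, hp, evalMultiset]

theorem carries_eq_zero {lam : ℕ → ℕ} (d p : ℕ) (hp : lam (n - d) < p) :
    carries lam n d p = 0 := by
  cases d with
  | zero => rw [carries, if_neg (by omega)]
  | succ d => rw [carries, if_neg (by omega)]

theorem sum_Ico_pow_mul_pow (x y : R) {b e : ℕ} (h : b ≤ e) :
    (x - y) * ∑ p ∈ Finset.Ico b e, x ^ p * y ^ (b + e - 1 - p) = x ^ e * y ^ b - x ^ b * y ^ e := by
  induction e, h using Nat.le_induction with
  | base => simp
  | succ e he ih =>
    have : ∑ p ∈ Finset.Ico b e, x ^ p * y ^ (b + (e + 1) - 1 - p) =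
        y * ∑ p ∈ Finset.Ico b e, x ^ p * y ^ (b + e - 1 - p) := by
      rw [Finset.mul_sum]
      refine Finset.sum_congr rfl fun p hp => ?_
      have := Finset.mem_Ico.1 hp
      have e1 : b + (e + 1) - 1 - p = (b + e - 1 - p) + 1 := by omega
      rw [e1, pow_succ]; ring
    rw [Finset.sum_Ico_succ_top he, this, mul_add, mul_left_comm, ih]
    have e2 : b + (e + 1) - 1 - e = b := by omega
    rw [e2]; ring

/-- For each `b`, the difference splits into `x^(a+1) y^b - x^b y^(a+1)` and the same expression
with `b + 1`; dividing by `x - y` gives two geometric sums, collected by the power of `x`. -/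
theorem divided_carry (x y : R) (C : ℕ → R) (a : ℕ) :
    (x - y) * ∑ p ∈ Finset.range (a + 1), x ^ p *
        ((∑ b ∈ Finset.range (p + 1), C b * y ^ (a + b - p)) +
          ∑ b ∈ Finset.range p, C b * y ^ (a + b + 1 - p)) =
      (1 + y) * (x ^ (a + 1) * ∑ b ∈ Finset.range (a + 1), y ^ b * C b) -
        (1 + x) * (y ^ (a + 1) * ∑ b ∈ Finset.range (a + 1), x ^ b * C b) := by
  have h1 : ∑ p ∈ Finset.range (a + 1), x ^ p *
      ∑ b ∈ Finset.range (p + 1), C b * y ^ (a + b - p) =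
      ∑ b ∈ Finset.range (a + 1), C b *
        ∑ p ∈ Finset.Ico b (a + 1), x ^ p * y ^ (b + (a + 1) - 1 - p) := by
    simp only [Finset.range_eq_Ico, Finset.mul_sum]
    rw [Finset.sum_Ico_Ico_comm]
    refine Finset.sum_congr rfl fun p _ => Finset.sum_congr rfl fun b _ => ?_
    have e : b + (a + 1) - 1 - p = a + b - p := by omega
    rw [e]; ring
  have h2 : ∑ p ∈ Finset.range (a + 1), x ^ p *
      ∑ b ∈ Finset.range p, C b * y ^ (a + b + 1 - p) =
      ∑ b ∈ Finset.range (a + 1), C b *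
        ∑ p ∈ Finset.Ico (b + 1) (a + 1), x ^ p * y ^ (b + 1 + (a + 1) - 1 - p) := by
    simp only [Finset.range_eq_Ico, Finset.mul_sum]
    rw [Finset.sum_Ico_Ico_comm']
    refine Finset.sum_congr rfl fun p _ => Finset.sum_congr rfl fun b _ => ?_
    have e : b + 1 + (a + 1) - 1 - p = a + b + 1 - p := by omega
    rw [e]; ring
  simp only [mul_add, Finset.sum_add_distrib]
  rw [← mul_add, h1, h2, mul_add]
  simp only [Finset.mul_sum]
  rw [← Finset.sum_add_distrib, ← Finset.sum_sub_distrib]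
  refine Finset.sum_congr rfl fun b hb => ?_
  have hb' := Finset.mem_range.1 hb
  have e1 := sum_Ico_pow_mul_pow x y (b := b) (e := a + 1) (by omega)
  have e2 := sum_Ico_pow_mul_pow x y (b := b + 1) (e := a + 1) (by omega)
  simp only [Finset.mul_sum] at e1 e2
  simp only [mul_left_comm (x - y) (C b), ← Finset.mul_sum] at e1 e2 ⊢
  rw [e1, e2]
  ring

/-- Start from the monomial of the 132-avoiding permutation and move the minimum back step by step.
Variables left of it keep their powers, its own variable carries the exponent `b`, and the later
ones are no longer touched. -/
theorem tilingSum_shiftFirst [IsDomain R] (π : Equiv.Perm (Fin (n + 1))) (h0 : π 0 = 0)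
    (hav : Avoids132 (shiftFirst π n)) (hanti : Antitone (tailCode π)) (d : ℕ) (hd : d ≤ n) :
    ∀ x : ℕ → R, GenericValues n x → tilingSum R n x (shiftFirst π (n - d)) =
      (∏ i ∈ Finset.range (n - d), x i ^ (tailCode π i + 1)) *
        ∑ b ∈ Finset.range (tailCode π (n - d) + 1),
          x (n - d) ^ b * evalMultiset x (carries (tailCode π) n d b) := by
  induction d with
  | zero =>
    intro x hx
    rw [Nat.sub_zero, tilingSum_of_avoids132 _ hav x hx, tailCode_of_le π (by omega),
      Fin.prod_univ_castSucc, Finset.prod_range]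
    simp only [lehmerCode_shiftFirst π h0 n le_rfl]
    simp [carries, evalMultiset]
  | succ d ih =>
    intro x hx
    obtain ⟨j, hj⟩ : ∃ j, j = n - (d + 1) := ⟨_, rfl⟩
    have hjn : j < n := by omega
    have hj' : n - d = j + 1 := by omega
    have ih' := ih (by omega)
    rw [hj'] at ih'
    have hC : ∀ b, evalMultiset (x ∘ Equiv.swap j (j + 1)) (carries (tailCode π) n d b) =
        evalMultiset x (carries (tailCode π) n d b) :=
      evalMultiset_carries_congr _ d (fun i h1 h2 => by
        rw [Function.comp_apply, Equiv.swap_apply_of_ne_of_ne (by omega) (by omega)]) (by omega)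
    have hP : ∏ i ∈ Finset.range j, (x ∘ Equiv.swap j (j + 1)) i ^ (tailCode π i + 1) =
        ∏ i ∈ Finset.range j, x i ^ (tailCode π i + 1) :=
      Finset.prod_congr rfl fun i hi => by
        have := Finset.mem_range.1 hi
        rw [Function.comp_apply, Equiv.swap_apply_of_ne_of_ne (by omega) (by omega)]
    -- Carries beyond the smaller code value vanish, so the sum may run up to the larger one, as
    -- `divided_carry` needs.
    have hlast : ∀ y : R, ∑ b ∈ Finset.range (tailCode π (j + 1) + 1),
        y ^ b * evalMultiset x (carries (tailCode π) n d b) =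
        ∑ b ∈ Finset.range (tailCode π j + 1),
          y ^ b * evalMultiset x (carries (tailCode π) n d b) := by
      intro y
      refine Finset.sum_subset (fun b hb => ?_) (fun b _ hb => ?_)
      · have := hanti (Nat.le_succ j)
        simp only [Finset.mem_range, Nat.succ_eq_add_one] at *
        omega
      · rw [carries_eq_zero d b (by rw [hj']; simp at hb; omega)]
        simp [evalMultiset]
    have hdiv := tilingSum_divided x hx.ne ⟨j, hjn⟩ (shiftFirst π j)
      (shiftFirst_lt π h0 ⟨j, hjn⟩)
    have hs := shiftFirst_succ π ⟨j, hjn⟩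
    simp only at hdiv hs
    rw [← hs, ih' x hx, ih' _ (hx.comp_swap hjn)] at hdiv
    simp only [Function.comp_apply] at hP
    simp only [hC, Finset.prod_range_succ, hP, hlast, Function.comp_apply,
      Equiv.swap_apply_left, Equiv.swap_apply_right] at hdiv
    refine mul_left_cancel₀ (hx.sub_ne_zero ⟨j, hjn⟩) ?_
    simp only
    rw [← hj]
    have hc := divided_carry (x j) (x (j + 1))
      (fun b => evalMultiset x (carries (tailCode π) n d b)) (tailCode π j)
    have hs' : ∑ b ∈ Finset.range (tailCode π j + 1),
        x j ^ b * evalMultiset x (carries (tailCode π) n (d + 1) b) =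
        ∑ p ∈ Finset.range (tailCode π j + 1), x j ^ p *
        ((∑ b ∈ Finset.range (p + 1), evalMultiset x (carries (tailCode π) n d b) *
          x (j + 1) ^ (tailCode π j + b - p)) +
          ∑ b ∈ Finset.range p, evalMultiset x (carries (tailCode π) n d b) *
            x (j + 1) ^ (tailCode π j + b + 1 - p)) := by
      refine Finset.sum_congr rfl fun p hp => ?_
      have := Finset.mem_range.1 hp
      rw [evalMultiset_carries_succ x _ d p (by rw [← hj]; omega), hj', ← hj]
    rw [hs']
    linear_combination hdiv - (∏ i ∈ Finset.range j, x i ^ (tailCode π i + 1)) * hc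

/-- The exponents of the coefficient of the permutation itself. -/
noncomputable def tilingExponents (lam : ℕ → ℕ) (n : ℕ) : Multiset (ℕ →₀ ℕ) :=
  ∑ b ∈ Finset.range (lam 0 + 1), (carries lam n n b).map fun α => α + Finsupp.single 0 b

theorem tilingSum_eq_evalMultiset [IsDomain R] (π : Equiv.Perm (Fin (n + 1))) (h0 : π 0 = 0)
    (hav : Avoids132 (shiftFirst π n)) (hanti : Antitone (tailCode π))
    (x : ℕ → R) (hx : GenericValues n x) :
    tilingSum R n x π = evalMultiset x (tilingExponents (tailCode π) n) := by
  have := tilingSum_shiftFirst π h0 hav hanti n le_rfl x hx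
  rw [Nat.sub_self, Finset.range_zero, Finset.prod_empty, one_mul] at this
  rw [tilingExponents, evalMultiset_sum]
  simp only [evalMultiset_map_add_single]
  simpa only [mul_comm, shiftFirst] using this

end Explicit

/-! ### Eliminating the carries: inequalities and multiplicities. -/

section Admissible

/-- The sum of `f` over the indices from `k` up to `n - 1`. -/
def suffixSum (n : ℕ) (f : ℕ → ℕ) (k : ℕ) : ℕ := ∑ i ∈ Finset.Ico k n, f i

theorem suffixSum_of_le {n k : ℕ} (f : ℕ → ℕ) (h : n ≤ k) : suffixSum n f k = 0 := by
  simp [suffixSum, Finset.Ico_eq_empty_of_le h]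

theorem suffixSum_eq_add {n k : ℕ} (f : ℕ → ℕ) (h : k < n) :
    suffixSum n f k = f k + suffixSum n f (k + 1) :=
  Finset.sum_eq_sum_Ico_succ_bot h f

theorem suffixSum_congr {n k : ℕ} {f g : ℕ → ℕ} (h : ∀ i, k ≤ i → i < n → f i = g i) :
    suffixSum n f k = suffixSum n g k :=
  Finset.sum_congr rfl fun i hi => h i (Finset.mem_Ico.1 hi).1 (Finset.mem_Ico.1 hi).2

theorem suffixSum_succ_le {n k : ℕ} {lam f : ℕ → ℕ} (h : ∀ i, k ≤ i → i < n → f (i + 1) ≤ lam i) :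
    suffixSum (n + 1) f (k + 1) ≤ suffixSum n lam k := by
  unfold suffixSum
  rw [← Finset.sum_Ico_add']
  exact Finset.sum_le_sum fun i hi => h i (Finset.mem_Ico.1 hi).1 (Finset.mem_Ico.1 hi).2

/-- The inequalities that describe the exponents `α` of the carry `p` at position `k`; `e` is the
excess of the degree. -/
def Admissible (lam : ℕ → ℕ) (n k p : ℕ) (α : ℕ →₀ ℕ) : Prop :=
  (∀ i, α i ≠ 0 → k < i ∧ i ≤ n) ∧ p ≤ lam k ∧ (∀ i, k ≤ i → i < n → α (i + 1) ≤ lam i) ∧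
    -- Each step adds at most one to the excess, so at position `i` at least `e - (i - k)` of it,
    -- truncated at zero, must come from later steps; the last inequality says that the carry there
    -- can still be at most `lam i`.
    ∃ e, suffixSum n lam k + e = p + suffixSum (n + 1) α (k + 1) ∧
      ∀ i, k ≤ i → i ≤ n → suffixSum n lam (i + 1) + (e - (i - k)) ≤ suffixSum (n + 1) α (i + 1)

variable {lam : ℕ → ℕ} {n : ℕ}

theorem mem_carries_succ {d p : ℕ} {α : ℕ →₀ ℕ} :
    α ∈ carries lam n (d + 1) p ↔ p ≤ lam (n - (d + 1)) ∧ ∃ b δ, δ ≤ 1 ∧ b + δ ≤ p ∧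
      ∃ α' ∈ carries lam n d b,
        α' + Finsupp.single (n - d) (lam (n - (d + 1)) + b + δ - p) = α := by
  by_cases hp : p ≤ lam (n - (d + 1))
  · rw [carries, if_pos hp]
    simp only [Multiset.mem_add, Multiset.mem_sum, Multiset.mem_map, Finset.mem_range, hp,
      true_and]
    constructor
    · rintro (⟨b, hb, α', h1, h2⟩ | ⟨b, hb, α', h1, h2⟩)
      · exact ⟨b, 0, by omega, by omega, α', h1, h2⟩
      · exact ⟨b, 1, by omega, by omega, α', h1, h2⟩
    · rintro ⟨b, δ, hδ, hb, α', h1, h2⟩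
      obtain rfl | rfl : δ = 0 ∨ δ = 1 := by omega
      · exact Or.inl ⟨b, by omega, α', h1, h2⟩
      · exact Or.inr ⟨b, by omega, α', h1, h2⟩
  · simp [carries, hp]

theorem Admissible.step {k b p δ : ℕ} {α : ℕ →₀ ℕ} (hk : k < n) (h : Admissible lam n (k + 1) b α)
    (hp : p ≤ lam k) (hδ : δ ≤ 1) (hb : b + δ ≤ p) :
    Admissible lam n k p (α + Finsupp.single (k + 1) (lam k + b + δ - p)) := by
  obtain ⟨h1, h2, h3, e, h4, h5⟩ := h
  set c := lam k + b + δ - p with hc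
  have hαk : α (k + 1) = 0 := by
    by_contra h; have := (h1 _ h).1; omega
  have hval : ∀ i, i ≠ k + 1 → (α + Finsupp.single (k + 1) c) i = α i := fun i hi => by
    simp [hi.symm]
  have hvalk : (α + Finsupp.single (k + 1) c) (k + 1) = c := by simp [hαk]
  have hsuf : ∀ i, k + 1 ≤ i → suffixSum (n + 1) ⇑(α + Finsupp.single (k + 1) c : ℕ →₀ ℕ) (i + 1) =
      suffixSum (n + 1) α (i + 1) := fun i hi => suffixSum_congr fun j hj _ => hval j (by omega)
  have e1 := suffixSum_eq_add (⇑(α + Finsupp.single (k + 1) c)) (by omega : k + 1 < n + 1)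
  have e2 := suffixSum_eq_add lam hk
  rw [hvalk, hsuf (k + 1) le_rfl] at e1
  refine ⟨fun i hi => ?_, hp, fun i hi hin => ?_, e + δ, by omega, fun i hi hin => ?_⟩
  · by_cases hik : i = k + 1
    · omega
    · rw [hval i hik] at hi
      have := h1 i hi
      omega
  · by_cases hik : i = k
    · subst hik; rw [hvalk]; omega
    · rw [hval _ (by omega)]
      exact h3 i (by omega) hin
  · by_cases hik : i = k
    · subst hik; omega
    · rw [hsuf i (by omega)]
      have := h5 i (by omega) hin
      omega

/-- A unit of excess is spent now whenever some is left. This leaves the least excess, hence the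
weakest requirement, for later; the degree then determines the carry `b`. -/
theorem Admissible.exists_step {k p : ℕ} {α : ℕ →₀ ℕ} (hk : k < n)
    (h : Admissible lam n k p α) :
    ∃ b δ, δ ≤ 1 ∧ b + δ ≤ p ∧ Admissible lam n (k + 1) b (α.erase (k + 1)) ∧
      α.erase (k + 1) + Finsupp.single (k + 1) (lam k + b + δ - p) = α := by
  obtain ⟨h1, h2, h3, e, h4, h5⟩ := h
  have hsuf : ∀ i, k + 1 ≤ i → suffixSum (n + 1) (α.erase (k + 1)) (i + 1) =
      suffixSum (n + 1) α (i + 1) := fun i hi => suffixSum_congr fun j hj _ =>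
        Finsupp.erase_ne (by omega)
  have e1 := suffixSum_eq_add α (by omega : k + 1 < n + 1)
  have e2 := suffixSum_eq_add lam hk
  have e3 : suffixSum (n + 1) α (k + 1 + 1) ≤ suffixSum n lam (k + 1) :=
    suffixSum_succ_le fun i hi hin => h3 i (by omega) hin
  have e4 := h3 k le_rfl hk
  have e5 := h5 (k + 1) (by omega) (by omega)
  have e6 : suffixSum n lam (k + 1) ≤ lam (k + 1) + suffixSum n lam (k + 1 + 1) := by
    by_cases hkn : k + 1 < n
    · exact (suffixSum_eq_add lam hkn).le
    · rw [suffixSum_of_le lam (by omega)]; omega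
  refine ⟨suffixSum n lam (k + 1) + (e - min e 1) - suffixSum (n + 1) α (k + 1 + 1), min e 1,
    by omega, by omega, ⟨fun i hi => ?_, by omega, fun i hi hin => ?_, e - min e 1, ?_,
      fun i hi hin => ?_⟩, ?_⟩
  · have hik : i ≠ k + 1 := by rintro rfl; simp at hi
    rw [Finsupp.erase_ne hik] at hi
    have := h1 i hi
    omega
  · rw [Finsupp.erase_ne (by omega)]
    exact h3 i (by omega) hin
  · rw [hsuf _ le_rfl]; omega
  · rw [hsuf i hi]
    have := h5 i (by omega) hin
    omega
  · have : lam k + (suffixSum n lam (k + 1) + (e - min e 1) - suffixSum (n + 1) α (k + 1 + 1)) +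
        min e 1 - p = α (k + 1) := by omega
    rw [this, Finsupp.erase_add_single]

theorem mem_carries (hlam : lam n = 0) {d : ℕ} (hd : d ≤ n) : ∀ {p : ℕ} {α : ℕ →₀ ℕ},
    α ∈ carries lam n d p ↔ Admissible lam n (n - d) p α := by
  induction d with
  | zero =>
    intro p α
    simp only [carries, Nat.sub_zero]
    constructor
    · intro h
      split_ifs at h with hp
      · subst hp
        obtain rfl := Multiset.mem_singleton.1 h
        refine ⟨by simp, by omega, by simp, 0, ?_, fun i hi hin => ?_⟩
        · rw [suffixSum_of_le _ le_rfl, suffixSum_of_le _ le_rfl]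
        · rw [suffixSum_of_le _ (by omega), suffixSum_of_le _ (by omega)]; omega
      · simp at h
    · rintro ⟨h1, h2, -⟩
      have hα : α = 0 := by
        ext i
        by_contra h
        have := h1 i h
        omega
      rw [if_pos (by omega), hα]
      simp
  | succ d ih =>
    intro p α
    have hk : n - (d + 1) < n := by omega
    have hk' : n - (d + 1) + 1 = n - d := by omega
    rw [mem_carries_succ]
    constructor
    · rintro ⟨hp, b, δ, hδ, hb, α', hα', rfl⟩
      rw [ih (by omega), ← hk'] at hα'
      rw [← hk']
      exact hα'.step hk hp hδ hb
    · intro h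
      obtain ⟨b, δ, hδ, hb, h', heq⟩ := h.exists_step hk
      rw [hk', ← ih (by omega)] at h'
      rw [hk'] at heq
      exact ⟨h.2.1, b, δ, hδ, hb, _, h', heq⟩

theorem count_map_add_single {M : Multiset (ℕ →₀ ℕ)} {k : ℕ} (hM : ∀ α ∈ M, α k = 0) (c : ℕ)
    (α : ℕ →₀ ℕ) :
    (M.map fun β => β + Finsupp.single k c).count α =
      if α k = c then M.count (α.erase k) else 0 := by
  split_ifs with h
  · have hα : α = α.erase k + Finsupp.single k c := by rw [← h, Finsupp.erase_add_single]
    conv_lhs => rw [hα]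
    exact Multiset.count_map_eq_count' _ _ (add_left_injective _) _
  · rw [Multiset.count_eq_zero, Multiset.mem_map]
    rintro ⟨β, hβ, rfl⟩
    simp [hM β hβ] at h

theorem sum_ite_le_one {s : Finset ℕ} {P : ℕ → Prop} [DecidablePred P] {f : ℕ → ℕ}
    (hP : ∀ a ∈ s, ∀ b ∈ s, P a → P b → a = b) (hf : ∀ a ∈ s, P a → f a ≤ 1) :
    ∑ a ∈ s, (if P a then f a else 0) ≤ 1 := by
  by_cases h : ∃ a ∈ s, P a
  · obtain ⟨a, ha, hPa⟩ := h
    rw [Finset.sum_eq_single_of_mem a ha fun b hb hne => if_neg fun hPb =>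
      hne (hP b hb a ha hPb hPa), if_pos hPa]
    exact hf a ha hPa
  · push Not at h
    rw [Finset.sum_eq_zero fun a ha => if_neg (h a ha)]
    omega

theorem suffixSum_erase {k : ℕ} (α : ℕ →₀ ℕ) :
    suffixSum (n + 1) (α.erase k) (k + 1) = suffixSum (n + 1) α (k + 1) :=
  suffixSum_congr fun j hj _ => Finsupp.erase_ne (by omega)

/-- Exponents of minimal degree occur at most once. -/
theorem count_carries_le_one (hlam : lam n = 0) {d : ℕ} (hd : d ≤ n) : ∀ {p : ℕ} {α : ℕ →₀ ℕ},
    p + suffixSum (n + 1) α (n - d + 1) ≤ suffixSum n lam (n - d) →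
      (carries lam n d p).count α ≤ 1 := by
  induction d with
  | zero =>
    intro p α _
    simp only [carries]
    split_ifs
    · exact Multiset.nodup_iff_count_le_one.1 (Multiset.nodup_singleton _) α
    · simp
  | succ d ih =>
    intro p α h
    have ih' := @ih (by omega)
    obtain ⟨k, hk⟩ : ∃ k, k = n - (d + 1) := ⟨_, rfl⟩
    have hkd : n - d = k + 1 := by omega
    have hM : ∀ b, ∀ β ∈ carries lam n d b, β (k + 1) = 0 := by
      intro b β hβ
      by_contra hne
      have := (((mem_carries hlam (by omega)).1 hβ).1 _ hne).1
      omega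
    rw [carries]
    rw [← hk] at h ⊢
    rw [hkd] at ih' ⊢
    split_ifs with hp
    · rw [Multiset.count_add, Multiset.count_sum', Multiset.count_sum']
      simp only [count_map_add_single (hM _)]
      have e1 := suffixSum_eq_add α (by omega : k + 1 < n + 1)
      have e2 := suffixSum_eq_add lam (by omega : k < n)
      -- Terms of the second kind exceed the minimal degree. In the first sum `b` is determined by
      -- `α (k + 1)`.
      have e3 : ∑ b ∈ Finset.range p, (if α (k + 1) = lam k + b + 1 - p then
          (carries lam n d b).count (α.erase (k + 1)) else 0) = 0 := by
        refine Finset.sum_eq_zero fun b hb => ?_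
        split_ifs with hα
        · rw [Multiset.count_eq_zero, mem_carries hlam (by omega), hkd]
          rintro ⟨-, -, -, e, he, -⟩
          rw [suffixSum_erase] at he
          have := Finset.mem_range.1 hb
          omega
        · rfl
      rw [e3, add_zero]
      refine sum_ite_le_one (fun a ha b hb h1 h2 => ?_) fun b hb hα => ih' ?_
      · have := Finset.mem_range.1 ha
        have := Finset.mem_range.1 hb
        omega
      · rw [suffixSum_erase]
        have := Finset.mem_range.1 hb
        omega
    · simp

theorem mem_tilingExponents (hlam : lam n = 0) {α : ℕ →₀ ℕ} :
    α ∈ tilingExponents lam n ↔ (∀ i, n < i → α i = 0) ∧ α 0 ≤ lam 0 ∧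
      (∀ i < n, α (i + 1) ≤ lam i) ∧ ∃ e, suffixSum n lam 0 + e = suffixSum (n + 1) α 0 ∧
        ∀ i ≤ n, suffixSum n lam (i + 1) + (e - i) ≤ suffixSum (n + 1) α (i + 1) := by
  simp only [tilingExponents, Multiset.mem_sum, Multiset.mem_map, Finset.mem_range,
    mem_carries hlam le_rfl, Nat.sub_self]
  constructor
  · rintro ⟨b, hb, β, ⟨h1, h2, h3, e, h4, h5⟩, rfl⟩
    have hβ0 : β 0 = 0 := by
      by_contra h; have := (h1 0 h).1; omega
    have hval : ∀ i, i ≠ 0 → (β + Finsupp.single 0 b : ℕ →₀ ℕ) i = β i := fun i hi => by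
      simp [hi.symm]
    have hsuf : ∀ i, suffixSum (n + 1) ⇑(β + Finsupp.single 0 b : ℕ →₀ ℕ) (i + 1) =
        suffixSum (n + 1) β (i + 1) := fun i => suffixSum_congr fun j hj _ => hval j (by omega)
    refine ⟨fun i hi => ?_, ?_, fun i hi => ?_, e, ?_, fun i hi => ?_⟩
    · rw [hval i (by omega)]
      by_contra h
      have := (h1 i h).2
      omega
    · simp [hβ0]; omega
    · rw [hval _ (by omega)]
      exact h3 i (by omega) hi
    · rw [suffixSum_eq_add _ (by omega : 0 < n + 1), hsuf]
      simp only [Finsupp.add_apply, hβ0, Finsupp.single_eq_same, zero_add]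
      exact h4
    · rw [hsuf]
      exact h5 i (by omega) hi
  · rintro ⟨h1, h2, h3, e, h4, h5⟩
    have hsuf : ∀ i, suffixSum (n + 1) (α.erase 0) (i + 1) = suffixSum (n + 1) α (i + 1) :=
      fun i => suffixSum_congr fun j hj _ => Finsupp.erase_ne (by omega)
    refine ⟨α 0, by omega, α.erase 0, ⟨fun i hi => ?_, h2, fun i _ hi => ?_, e, ?_,
      fun i _ hi => ?_⟩, Finsupp.erase_add_single 0 α⟩
    · have hi0 : i ≠ 0 := by rintro rfl; simp at hi
      rw [Finsupp.erase_ne hi0] at hi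
      refine ⟨by omega, ?_⟩
      by_contra hcon
      exact hi (h1 i (by omega))
    · rw [Finsupp.erase_ne (by omega)]
      exact h3 i hi
    · rw [hsuf, h4, suffixSum_eq_add _ (by omega : 0 < n + 1)]
    · rw [hsuf]
      exact h5 i hi

theorem count_tilingExponents_le_one (hlam : lam n = 0) {α : ℕ →₀ ℕ}
    (h : suffixSum (n + 1) α 0 = suffixSum n lam 0) : (tilingExponents lam n).count α ≤ 1 := by
  have hM : ∀ b, ∀ β ∈ carries lam n n b, β 0 = 0 := by
    intro b β hβ
    by_contra hne
    have := (((mem_carries hlam le_rfl).1 hβ).1 _ hne).1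
    omega
  rw [tilingExponents, Multiset.count_sum']
  simp only [count_map_add_single (hM _)]
  refine sum_ite_le_one (fun a _ b _ h1 h2 => h1.symm.trans h2) fun b hb hα =>
    count_carries_le_one hlam le_rfl ?_
  rw [Nat.sub_self, suffixSum_erase, ← h, suffixSum_eq_add _ (by omega : 0 < n + 1), hα]

end Admissible

/-! ### From exponents to polytopes. -/

section Support

variable {n : ℕ}

/-- The inequalities that describe the exponents of the Grothendieck polynomial. -/
def SupportInequalities {𝕜 : Type*} [CommRing 𝕜] [LinearOrder 𝕜] (lam : ℕ → ℕ) (t : Fin n → 𝕜) :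
    Prop :=
  -- The subtraction is truncated: coordinates `0` and `1` are both bounded by `lam 0`. Below, the
  -- truncated excess term becomes two linear conditions; in the second the total degree cancels.
  (∀ i : Fin n, t i ≤ lam (i - 1)) ∧ (suffixSum n lam 0 : 𝕜) ≤ ∑ i, t i ∧
    ∀ k, 1 ≤ k → k ≤ n → (∑ i with i.val < k, t i) + suffixSum n lam k ≤ ∑ i, t i ∧
      (∑ i with i.val < k, t i) + suffixSum n lam k + 1 ≤ suffixSum n lam 0 + k

theorem supportInequalities_intCast (lam : ℕ → ℕ) (p : Fin n → ℤ) :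
    SupportInequalities lam (fun i => (p i : ℝ)) ↔ SupportInequalities lam p := by
  unfold SupportInequalities
  beta_reduce
  norm_cast

theorem convex_supportInequalities (lam : ℕ → ℕ) :
    Convex ℝ {t : Fin n → ℝ | SupportInequalities lam t} := by
  intro x hx y hy a b ha hb hab
  obtain ⟨x1, x2, x3⟩ := hx
  obtain ⟨y1, y2, y3⟩ := hy
  have hs : ∀ I : Finset (Fin n), ∑ i ∈ I, (a • x + b • y) i =
      a * ∑ i ∈ I, x i + b * ∑ i ∈ I, y i := fun I => by
    simp [Finset.sum_add_distrib, Finset.mul_sum]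
  have hcomb : ∀ {u u' v v' : ℝ}, u ≤ u' → v ≤ v' → a * u + b * v ≤ a * u' + b * v' :=
    fun h1 h2 => add_le_add (mul_le_mul_of_nonneg_left h1 ha) (mul_le_mul_of_nonneg_left h2 hb)
  obtain rfl : b = 1 - a := by linarith
  refine ⟨fun i => ?_, ?_, fun k h1 h2 => ⟨?_, ?_⟩⟩
  · have := hcomb (x1 i) (y1 i)
    simp only [Pi.add_apply, Pi.smul_apply, smul_eq_mul]
    linarith
  · rw [hs]
    have := hcomb x2 y2
    linarith
  · rw [hs, hs]
    have := hcomb (x3 k h1 h2).1 (y3 k h1 h2).1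
    linarith
  · rw [hs]
    have := hcomb (x3 k h1 h2).2 (y3 k h1 h2).2
    linarith

/-- Extend an exponent vector by zeros. -/
noncomputable def extendExponent (α : Fin n →₀ ℕ) : ℕ →₀ ℕ := α.embDomain Fin.valEmbedding

theorem extendExponent_apply (α : Fin n →₀ ℕ) (i : Fin n) : extendExponent α i = α i :=
  Finsupp.embDomain_apply_self Fin.valEmbedding α i

theorem extendExponent_of_le (α : Fin n →₀ ℕ) {j : ℕ} (h : n ≤ j) : extendExponent α j = 0 :=
  Finsupp.embDomain_of_notMem_range _ _ _ (by
    rintro ⟨i, rfl⟩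
    have := i.2
    simp only [Fin.valEmbedding_apply] at h
    omega)

theorem exists_extendExponent (α : ℕ →₀ ℕ) (h : ∀ i, n ≤ i → α i = 0) :
    ∃ β : Fin n →₀ ℕ, α = extendExponent β := by
  refine ⟨Finsupp.equivFunOnFinite.symm fun i => α i, ?_⟩
  ext j
  by_cases hj : j < n
  · exact (extendExponent_apply (Finsupp.equivFunOnFinite.symm fun i : Fin n => α i)
      ⟨j, hj⟩).symm
  · rw [extendExponent_of_le _ (by omega), h j (by omega)]

theorem sum_filter_lt (f : ℕ → ℤ) {k : ℕ} (hk : k ≤ n) :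
    ∑ i : Fin n with i.val < k, f i = ∑ j ∈ Finset.range k, f j := by
  rw [Finset.sum_filter, Fin.sum_univ_eq_sum_range (fun j => if j < k then f j else 0) n,
    ← Finset.sum_filter]
  congr 1
  ext j
  simp only [Finset.mem_filter, Finset.mem_range]
  omega

theorem sum_range_add_suffixSum (f : ℕ → ℕ) {k m : ℕ} (hk : k ≤ m) :
    ∑ j ∈ Finset.range k, f j + suffixSum m f k = suffixSum m f 0 := by
  unfold suffixSum
  rw [Finset.range_eq_Ico]
  exact Finset.sum_Ico_consecutive _ (Nat.zero_le _) hk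

/-- The integer solutions of the inequalities are nonnegative. -/
theorem SupportInequalities.nonneg {lam : ℕ → ℕ} {p : Fin n → ℤ}
    (h : SupportInequalities lam p) (i : Fin n) : 0 ≤ p i := by
  obtain ⟨h1, h2, h3⟩ := h
  set q : ℕ → ℤ := fun j => if h : j < n then p ⟨j, h⟩ else 0 with hq
  have hqp : ∀ i : Fin n, p i = q i := fun i => by simp [hq]
  simp only [hqp] at h1 h2 h3 ⊢
  have hT : ∑ i : Fin n, q i = ∑ j ∈ Finset.range n, q j := Fin.sum_univ_eq_sum_range q n
  rw [hT] at h2 h3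
  -- Bounding every coordinate after `k` by the shifted code bounds the total from above; comparing
  -- with the lower bound for the total at `i` leaves `0 ≤ p i`.
  have key : ∀ d k, k + d + 1 = n →
      ∑ j ∈ Finset.range n, q j ≤ ∑ j ∈ Finset.range (k + 1), q j + suffixSum n lam k := by
    intro d
    induction d with
    | zero => rintro k rfl; simp
    | succ d ih =>
      intro k hk
      have e1 := ih (k + 1) (by omega)
      have e2 := h1 ⟨k + 1, by omega⟩
      rw [Finset.sum_range_succ] at e1
      have e3 := suffixSum_eq_add lam (by omega : k < n)
      simp only [Nat.add_sub_cancel] at e2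
      rw [e3]; push_cast
      linarith
  have e1 := key (n - 1 - i) i (by omega)
  rw [Finset.sum_range_succ] at e1
  rcases Nat.eq_zero_or_pos i.val with h0 | h0
  · rw [h0] at e1 ⊢
    simp only [Finset.range_zero, Finset.sum_empty] at e1
    omega
  · have e2 := (h3 i h0 i.2.le).1
    rw [sum_filter_lt q i.2.le] at e2
    linarith

theorem extendExponent_mem_iff {lam : ℕ → ℕ} (hlam : ∀ i, n ≤ i + 1 → lam i = 0)
    (α : Fin n →₀ ℕ) :
    extendExponent α ∈ tilingExponents lam n ↔
      SupportInequalities lam (fun i => (α i : ℤ)) := by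
  rw [mem_tilingExponents (hlam n (by omega))]
  set a := extendExponent α with ha
  have hα : ∀ i : Fin n, α i = a i := fun i => (extendExponent_apply α i).symm
  have ha0 : ∀ j, n ≤ j → a j = 0 := fun j hj => extendExponent_of_le α hj
  have hT : ∑ i : Fin n, (α i : ℤ) = (suffixSum (n + 1) a 0 : ℕ) := by
    simp only [hα]
    rw [Fin.sum_univ_eq_sum_range (fun j => (a j : ℤ)) n, suffixSum, ← Finset.range_eq_Ico,
      Finset.sum_range_succ, ha0 n le_rfl]
    push_cast; simp
  have hP : ∀ k ≤ n, ∑ i : Fin n with i.val < k, (α i : ℤ) + (suffixSum (n + 1) a k : ℕ) =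
      (suffixSum (n + 1) a 0 : ℕ) := by
    intro k hk
    simp only [hα]
    rw [sum_filter_lt (fun j => (a j : ℤ)) hk, ← sum_range_add_suffixSum a (by omega : k ≤ n + 1)]
    push_cast; rfl
  unfold SupportInequalities
  beta_reduce
  rw [hT]
  constructor
  · rintro ⟨-, h2, h3, e, h4, h5⟩
    refine ⟨fun i => ?_, by omega, fun k hk1 hkn => ?_⟩
    · rw [hα]
      obtain ⟨i, hi⟩ := i
      rcases i with _ | i
      · exact_mod_cast h2
      · exact_mod_cast h3 i (by omega)
    · have e1 := hP k hkn
      have e2 := h5 (k - 1) (by omega)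
      rw [Nat.sub_add_cancel hk1] at e2
      omega
  · rintro ⟨h1, h2, h3⟩
    refine ⟨fun i hi => ha0 i hi.le, ?_, fun i hi => ?_,
      suffixSum (n + 1) a 0 - suffixSum n lam 0, by omega, fun i hi => ?_⟩
    · by_cases hn : 0 < n
      · have := h1 ⟨0, hn⟩
        rw [hα] at this
        exact_mod_cast this
      · rw [ha0 0 (by omega)]; omega
    · by_cases hin : i + 1 < n
      · have := h1 ⟨i + 1, hin⟩
        rw [hα] at this
        exact_mod_cast this
      · rw [ha0 _ (by omega)]; omega
    · rcases Nat.lt_or_ge i n with hin | hin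
      · have e1 := hP (i + 1) hin
        have e2 := h3 (i + 1) (by omega) hin
        push_cast at e2
        omega
      · rw [suffixSum_of_le lam (by omega), suffixSum_of_le a (by omega : n + 1 ≤ i + 1)]
        by_cases hn : 0 < n
        · have e1 := hP n le_rfl
          have e2 := h3 n hn le_rfl
          rw [suffixSum_eq_add _ (by omega : n < n + 1), ha0 n le_rfl,
            suffixSum_of_le _ le_rfl] at e1
          rw [suffixSum_of_le _ le_rfl] at e2
          push_cast at e1 e2
          omega
        · have e1 : suffixSum (n + 1) a 0 = 0 := by
            rw [suffixSum_eq_add _ (by omega : 0 < n + 1), ha0 0 (by omega),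
              suffixSum_of_le _ (by omega)]
          omega

/-- The variables, continued by zeros. -/
noncomputable def extendedX (n : ℕ) (i : ℕ) : MvPolynomial (Fin n) ℤ :=
  if h : i < n then MvPolynomial.X ⟨i, h⟩ else 0

theorem extendedX_val (i : Fin n) : extendedX n i = MvPolynomial.X i := by
  simp [extendedX]

theorem genericValues_extendedX (n : ℕ) : GenericValues n (extendedX n) where
  inj i hi j hj h := by
    unfold extendedX at h
    split_ifs at h with h1 h2 h2
    · simpa using MvPolynomial.X_injective h
    · exact absurd h (MvPolynomial.X_ne_zero _)
    · exact absurd h.symm (MvPolynomial.X_ne_zero _)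
    · omega
  ne i h := by
    have := congrArg (MvPolynomial.constantCoeff) h
    unfold extendedX at this
    split_ifs at this <;> simp at this

theorem coeff_evalMultiset (M : Multiset (ℕ →₀ ℕ)) (hM : ∀ α ∈ M, ∀ i, n ≤ i → α i = 0)
    (β : Fin n →₀ ℕ) :
    (evalMultiset (extendedX n) M).coeff β = M.count (extendExponent β) := by
  induction M using Multiset.induction_on with
  | empty => simp [evalMultiset]
  | cons α M ih =>
    obtain ⟨γ, rfl⟩ := exists_extendExponent α (hM α (Multiset.mem_cons_self _ _))
    have ih' := ih fun α hα => hM α (Multiset.mem_cons_of_mem hα)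
    have hprod : ((extendExponent γ).prod fun i e => extendedX n i ^ e) =
        MvPolynomial.monomial γ 1 := by
      rw [extendExponent, Finsupp.prod_embDomain, MvPolynomial.monomial_eq]
      simp [extendedX_val]
    have hinj : extendExponent γ = extendExponent β ↔ γ = β :=
      (Finsupp.embDomain_injective _).eq_iff
    rw [evalMultiset, Multiset.map_cons, Multiset.sum_cons, MvPolynomial.coeff_add, hprod,
      MvPolynomial.coeff_monomial, Multiset.count_cons]
    rw [evalMultiset] at ih'
    rw [ih']
    simp only [eq_comm (a := extendExponent β), hinj]
    split_ifs <;> push_cast <;> ring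

theorem grothendieckPoly_eq_tilingSum (π : Equiv.Perm (Fin (n + 1))) :
    grothendieckPoly π = tilingSum (MvPolynomial (Fin n) ℤ) n (extendedX n) π := by
  rw [tilingSum_apply]
  refine Finset.sum_congr rfl fun D _ => Finset.prod_congr rfl fun c _ => ?_
  rw [extendedX_val]

/-- The degree of a weight is the number of crosses, which equals the inversion number exactly for
reduced tilings. -/
theorem schubertPoly_eq_homogeneousComponent (π : Equiv.Perm (Fin (n + 1))) :
    schubertPoly π =
      MvPolynomial.homogeneousComponent (inversionNumber π) (grothendieckPoly π) := by
  classical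
  rw [schubertPoly, grothendieckPoly, map_sum, reducedPipeDreams, Finset.sum_filter]
  refine Finset.sum_congr rfl fun D hD => ?_
  have hhom : (pipeWeight D).IsHomogeneous D.card := by
    have := MvPolynomial.IsHomogeneous.prod D
      (fun c : Tile n => (MvPolynomial.X c.1.1 : MvPolynomial (Fin n) ℤ)) (fun _ => 1)
      (fun c _ => MvPolynomial.isHomogeneous_X _ _)
    simpa [pipeWeight] using this
  rw [MvPolynomial.homogeneousComponent_of_mem hhom, isReducedTiling_iff]
  have : strandPerm D = π := by simpa [pipeDreams] using hD
  rw [this]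
  simp only [eq_comm]

/-- The Newton polytope lies between the exponents and the convex set `Q`, which has no other
integer points. -/
theorem hasPolytopalSupport_of_convex (f : MvPolynomial (Fin n) ℤ) {Q : Set (Fin n → ℝ)}
    (hQ : Convex ℝ Q) (h : ∀ p : Fin n → ℤ, (fun i => (p i : ℝ)) ∈ Q ↔
      ∃ α : Fin n →₀ ℕ, f.coeff α ≠ 0 ∧ p = fun i => (α i : ℤ)) : HasPolytopalSupport f := by
  have hsub : exponentVectors f ⊆ Q := by
    rintro _ ⟨α, hα, rfl⟩
    have := (h fun i => (α i : ℤ)).2 ⟨α, hα, rfl⟩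
    simpa using this
  ext p
  refine ⟨fun hp => (h p).1 (convexHull_min hsub hQ hp), ?_⟩
  rintro ⟨α, hα, rfl⟩
  exact subset_convexHull ℝ _ ⟨α, hα, by simp⟩

theorem isGeneralizedPermutahedron_newtonPolytope {lam : ℕ → ℕ} {d : ℕ}
    {f : MvPolynomial (Fin n) ℤ} (hf : f ≠ 0)
    (h : ∀ p : Fin n → ℤ, (SupportInequalities lam p ∧ ∑ i, p i = d) ↔
      ∃ α : Fin n →₀ ℕ, f.coeff α ≠ 0 ∧ p = fun i => (α i : ℤ)) :
    IsGeneralizedPermutahedron (newtonPolytope f) := by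
  classical
  set A : Finset (Fin n → ℤ) := f.support.image fun α i => (α i : ℤ) with hAdef
  have hA : ∀ p, p ∈ A ↔ SupportInequalities lam p ∧ ∑ i, p i = d := fun p => by
    rw [h, hAdef]; simp [eq_comm]
  have hne : A.Nonempty := (MvPolynomial.support_nonempty.2 hf).image _
  have himage : exponentVectors f =
      (fun (α : Fin n → ℤ) (i : Fin n) => (α i : ℝ)) '' (A : Set (Fin n → ℤ)) := by
    ext x
    simp only [exponentVectors, hAdef, Set.mem_ofPred_eq, Finset.coe_image, Set.mem_image,
      Finset.mem_coe, MvPolynomial.mem_support_iff, exists_exists_and_eq_and, Int.cast_natCast]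
    simp only [eq_comm]
  rw [newtonPolytope, himage]
  refine SymmetricExchange.isGeneralizedPermutahedron hne (s := d) ?_ fun p hp => ((hA p).1 hp).2
  obtain ⟨p₀, hp₀⟩ := hne
  obtain ⟨⟨-, b2, b3⟩, b4⟩ := (hA p₀).1 hp₀
  -- With the degree fixed, both families of inequalities bound prefix sums. The condition at `k =
  -- n` concerns only the total and is inherited from the point `p₀`.
  refine symmetricExchange_of_box_chain (fun i => lam (i - 1))
    (fun k => if k = 0 then 0 else
      min ((d : ℤ) - suffixSum n lam k) (suffixSum n lam 0 + k - 1 - suffixSum n lam k)) d ?_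
  intro p
  rw [hA]
  constructor
  · rintro ⟨⟨h1, h2, h3⟩, h4⟩
    refine ⟨h1, fun k hk => ?_, h4⟩
    split_ifs with hk0
    · simp [hk0]
    · have := h3 k (by omega) hk.le
      rw [le_min_iff]
      omega
  · rintro ⟨h1, h3, h4⟩
    refine ⟨⟨h1, by omega, fun k hk1 hkn => ?_⟩, h4⟩
    rcases hkn.lt_or_eq with hk | rfl
    · have := h3 k hk
      rw [if_neg (by omega), le_min_iff] at this
      omega
    · have e1 : ∀ p : Fin k → ℤ, ∑ i with i.val < k, p i = ∑ i, p i := fun p => by simp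
      have := b3 k hk1 le_rfl
      rw [e1] at this ⊢
      omega

theorem isIntegerPointTransform_of_hasPolytopalSupport {f : MvPolynomial (Fin n) ℤ}
    (hf : HasPolytopalSupport f) (h1 : ∀ α, f.coeff α ≠ 0 → f.coeff α = 1) :
    IsIntegerPointTransform f (newtonPolytope f) := by
  classical
  have hset : integerPoints (newtonPolytope f) =
      ((f.support.image fun (α : Fin n →₀ ℕ) (i : Fin n) => (α i : ℤ) : Finset (Fin n → ℤ)) :
        Set (Fin n → ℤ)) := by
    rw [hf]
    ext p
    simp [eq_comm]
  have hfin : (integerPoints (newtonPolytope f)).Finite := by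
    rw [hset]; exact Finset.finite_toSet _
  refine ⟨hfin, ?_⟩
  have : hfin.toFinset = f.support.image fun (α : Fin n →₀ ℕ) (i : Fin n) => (α i : ℤ) := by
    apply Finset.coe_injective
    rw [Set.Finite.coe_toFinset, hset]
  rw [this, Finset.sum_image, toLaurent]
  · refine Finset.sum_congr rfl fun α hα => ?_
    rw [h1 α (MvPolynomial.mem_support_iff.1 hα)]
  · intro α _ β _ hαβ
    ext i
    have := congrFun hαβ i
    beta_reduce at this
    exact_mod_cast this

end Support

/-! ### Assembly of the theorem. -/

theorem theoremC (n : ℕ) (π : Equiv.Perm (Fin (n + 1))) (π' : Equiv.Perm (Fin n))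
    (hfirst : π 0 = 0) (hrest : ∀ i : Fin n, π i.succ = (π' i).succ)
    (hdom : IsDominantPerm π') :
    (HasPolytopalSupport (grothendieckPoly π) ∧
      ∀ d : ℕ, MvPolynomial.homogeneousComponent d (grothendieckPoly π) ≠ 0 →
        IsGeneralizedPermutahedron
          (newtonPolytope (MvPolynomial.homogeneousComponent d (grothendieckPoly π)))) ∧
    (HasPolytopalSupport (schubertPoly π) ∧
      IsGeneralizedPermutahedron (newtonPolytope (schubertPoly π)) ∧
      IsIntegerPointTransform (schubertPoly π) (newtonPolytope (schubertPoly π))) := by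
  set lam := tailCode π with hlamdef
  have hanti : Antitone lam := antitone_tailCode π π' hfirst hrest hdom.avoids132
  have hlam : ∀ i, n ≤ i + 1 → lam i = 0 := fun i => tailCode_of_le π
  have hcoeff : ∀ α, (grothendieckPoly π).coeff α =
      (tilingExponents lam n).count (extendExponent α) := by
    intro α
    rw [grothendieckPoly_eq_tilingSum, tilingSum_eq_evalMultiset π hfirst
      (avoids132_shiftFirst π π' hfirst hrest hdom.avoids132) hanti _ (genericValues_extendedX n)]
    refine coeff_evalMultiset _ (fun β hβ i hi => ?_) α
    obtain ⟨h1, h2, h3, -⟩ := (mem_tilingExponents (hlam n (by omega))).1 hβ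
    rcases i with _ | i
    · have := hlam 0 (by omega); omega
    · by_cases hin : i < n
      · have := h3 i hin
        have := hlam i (by omega)
        omega
      · exact h1 _ (by omega)
  have hsupp : ∀ α : Fin n →₀ ℕ, (grothendieckPoly π).coeff α ≠ 0 ↔
      SupportInequalities lam (fun i => (α i : ℤ)) := by
    intro α
    rw [hcoeff, ← extendExponent_mem_iff hlam]
    simp
  have hG : ∀ p : Fin n → ℤ, SupportInequalities lam p ↔
      ∃ α : Fin n →₀ ℕ, (grothendieckPoly π).coeff α ≠ 0 ∧ p = fun i => (α i : ℤ) := by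
    intro p
    constructor
    · intro hp
      obtain ⟨α, rfl⟩ : ∃ α : Fin n →₀ ℕ, p = fun i => (α i : ℤ) :=
        ⟨Finsupp.equivFunOnFinite.symm fun i => (p i).toNat, by
          ext i; simp [Int.toNat_of_nonneg (hp.nonneg i)]⟩
      exact ⟨α, (hsupp α).2 hp, rfl⟩
    · rintro ⟨α, hα, rfl⟩
      exact (hsupp α).1 hα
  have hdeg : ∀ α : Fin n →₀ ℕ, ((α.degree : ℕ) : ℤ) = ∑ i, (α i : ℤ) := fun α => by
    rw [Finsupp.degree_eq_sum]; push_cast; rfl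
  have hGd : ∀ d : ℕ, ∀ p : Fin n → ℤ, (SupportInequalities lam p ∧ ∑ i, p i = d) ↔
      ∃ α : Fin n →₀ ℕ,
        (MvPolynomial.homogeneousComponent d (grothendieckPoly π)).coeff α ≠ 0 ∧
          p = fun i => (α i : ℤ) := by
    intro d p
    simp only [MvPolynomial.coeff_homogeneousComponent, ne_eq, ite_eq_right_iff,
      Classical.not_imp]
    rw [hG]
    constructor
    · rintro ⟨⟨α, hα, rfl⟩, hs⟩
      rw [← hdeg] at hs
      exact ⟨α, ⟨by exact_mod_cast hs, hα⟩, rfl⟩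
    · rintro ⟨α, ⟨hs, hα⟩, rfl⟩
      refine ⟨⟨α, hα, rfl⟩, ?_⟩
      rw [← hdeg, hs]
  have hinv : inversionNumber π = suffixSum n lam 0 := by
    rw [inversionNumber_eq_sum_tailCode π hfirst, suffixSum, ← Finset.range_eq_Ico]
  have hpoly : HasPolytopalSupport (schubertPoly π) := by
    rw [schubertPoly_eq_homogeneousComponent]
    refine hasPolytopalSupport_of_convex _ (Q := {t | SupportInequalities lam t} ∩
      {t | ∑ i, t i = (inversionNumber π : ℝ)}) ((convex_supportInequalities lam).inter ?_) ?_
    · intro x hx y hy a b _ _ hab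
      simp only [Set.mem_ofPred_eq] at *
      simp only [Pi.add_apply, Pi.smul_apply, smul_eq_mul, Finset.sum_add_distrib,
        ← Finset.mul_sum, hx, hy, ← add_mul, hab, one_mul]
    · intro p
      rw [← hGd, ← supportInequalities_intCast]
      simp only [Set.mem_inter_iff, Set.mem_ofPred_eq]
      norm_cast
  refine ⟨⟨?_, fun d hd => isGeneralizedPermutahedron_newtonPolytope hd (hGd d)⟩, hpoly, ?_, ?_⟩
  · refine hasPolytopalSupport_of_convex _ (convex_supportInequalities lam) fun p => ?_
    rw [← hG, ← supportInequalities_intCast]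
    rfl
  · rw [schubertPoly_eq_homogeneousComponent]
    refine isGeneralizedPermutahedron_newtonPolytope ?_ (hGd _)
    have hP : ∀ k ≤ n, (∑ i : Fin n with i.val < k, (lam i : ℤ)) + suffixSum n lam k =
        suffixSum n lam 0 := fun k hk => by
      rw [sum_filter_lt (fun j => (lam j : ℤ)) hk, ← sum_range_add_suffixSum lam hk]
      push_cast; rfl
    have hT : ∑ i : Fin n, (lam i : ℤ) = suffixSum n lam 0 := by
      have := hP n le_rfl
      rw [suffixSum_of_le _ le_rfl] at this
      simpa using this
    -- The code `lam` itself satisfies the inequalities in the lowest degree, so the Schubert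
    -- polynomial is not zero.
    obtain ⟨α, hα, -⟩ := (hGd (inversionNumber π) fun i => (lam i : ℤ)).1
      ⟨⟨fun i => by beta_reduce; exact_mod_cast hanti (Nat.sub_le _ _), hT.ge, fun k hk1 hkn => by
        have := hP k hkn
        beta_reduce
        rw [hT]
        omega⟩, by rw [hT, hinv]⟩
    intro h0
    rw [h0] at hα
    simp at hα
  · refine isIntegerPointTransform_of_hasPolytopalSupport hpoly fun α hα => ?_
    rw [schubertPoly_eq_homogeneousComponent, MvPolynomial.coeff_homogeneousComponent] at hα ⊢
    split_ifs at hα ⊢ with hd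
    · rw [hcoeff] at hα ⊢
      have hle := count_tilingExponents_le_one (lam := lam) (n := n) (hlam n (by omega))
        (α := extendExponent α) (by
          rw [← hinv, ← hd, Finsupp.degree_eq_sum, suffixSum, ← Finset.range_eq_Ico,
            Finset.sum_range_succ, extendExponent_of_le α le_rfl, add_zero, Finset.sum_range]
          exact Finset.sum_congr rfl fun i _ => extendExponent_apply α i)
      have : (tilingExponents lam n).count (extendExponent α) ≠ 0 := by exact_mod_cast hα
      have : (tilingExponents lam n).count (extendExponent α) = 1 := by omega
      rw [this]; rfl
    · exact absurd rfl hα
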